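/- Let $\Lambda$ be a lattice in an $n$-dimensional Euclidean space $E$ that is similar to one of the following non-Cartesian crystallographic root lattices: $A_n$ or its dual $A_n^*$ with $n\ge 2$; $D_n$ or its dual $D_n^*$ with $n\ge 3$; the split $B_n$ with $n\ge 3$, i.e. the lattice generated by the edges $e_1,\dots,e_n$ of the cube lattice $B_n=\mathbb Z^n$ together with the half-diagonals $(\pm\frac12,\dots,\pm\frac12)$; or $E_6$, $E_7$, $E_8$. (Here $A_n$, $D_n$, $E_j$ denote the lattices spanned by a basis whose Gram matrix is the Cartan matrix of that type.) Let $$V=\{x\in E:\ \|x\|\le\|x-v\|\ \text{for all } v\in\Lambda\}$$ be the Voronoi cell of $\Lambda$, let $k\ge 1$, and let $M_k=\chi_V*\cdots*\chi_V$ be the $k$-fold convolution of the indicator function of $V$ with itself (so $M_1=\chi_V$). For $0<h<1$ and $t\in E$, consider the scaled and translated copy $t+h(v+V)$, $v\in\Lambda$, of the Voronoi tessellation $v+V$, $v\in\Lambda$, and its splines $x\mapsto M_k\big(h^{-1}(x-t)-v\big)$, $v\in\Lambda$. Call the splines $M_k(\cdot-v)$, $v\in\Lambda$, refinable if for some $0<h<1$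 and some $t\in E$ each of them coincides almost everywhere with a (finite) linear combination of the splines of that scaled copy. Then, for every $k\ge1$, the splines $M_k(\cdot-v)$, $v\in\Lambda$, are not refinable. -/

import Mathlib

open MeasureTheory
open scoped Convolution

noncomputable section VoronoiSplines

variable {E : Type*} [NormedAddCommGroup E] [InnerProductSpace ℝ E]

/-- The (closed) Voronoi cell of the site `0` of the lattice `Λ`: the points that are at least as
close to `0` as to every other lattice point. -/
def voronoiCell (Λ : Submodule ℤ E) : Set E :=
  {x | ∀ v ∈ Λ, ‖x‖ ≤ ‖x - v‖}

/-- `Λ` is the lattice spanned by a basis of `E` whose Gram matrix is a positive multiple of `G`.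
For `G` a simply laced Cartan matrix and the basis a system of simple roots, this says that `Λ` is
the root lattice of that type, up to a similarity. -/
def HasGramMatrix {n : ℕ} (G : Matrix (Fin n) (Fin n) ℤ) (Λ : Submodule ℤ E) : Prop :=
  ∃ r : ℝ, 0 < r ∧ ∃ b : Module.Basis (Fin n) ℝ E,
    (∀ i j, inner ℝ (b i) (b j) = r * (G i j : ℝ)) ∧ Λ = Submodule.span ℤ (Set.range b)

/-- `Λ` is the dual lattice `{x | ⟪x, y⟫ ∈ ℤ for all y ∈ Λ₀}` of a lattice `Λ₀` with Gram matrix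
proportional to `G`. -/
def IsDualOfGramMatrix {n : ℕ} (G : Matrix (Fin n) (Fin n) ℤ) (Λ : Submodule ℤ E) : Prop :=
  ∃ Λ₀ : Submodule ℤ E, HasGramMatrix G Λ₀ ∧
    ∀ x, x ∈ Λ ↔ ∀ y ∈ Λ₀, ∃ m : ℤ, inner ℝ x y = (m : ℝ)

/-- `Λ` is, up to a similarity, the cube lattice `ℤⁿ` with every cube split by its diagonals:
the lattice generated by the cube edges `eᵢ` and the half-diagonals `(±1/2, …, ±1/2)`. -/
def IsSplitCubeLattice (n : ℕ) (Λ : Submodule ℤ E) : Prop :=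
  ∃ r : ℝ, 0 < r ∧ ∃ e : Module.Basis (Fin n) ℝ E,
    (∀ i j, inner ℝ (e i) (e j) = if i = j then r else 0) ∧
    Λ = Submodule.span ℤ (Set.range e ∪
      {d | ∃ ε : Fin n → ℝ, (∀ i, ε i = 1 ∨ ε i = -1) ∧ d = (1 / 2 : ℝ) • ∑ i, ε i • e i})

/-- The non-Cartesian crystallographic root lattices (up to similarity): `Aₙ` and `Aₙ*` for
`n ≥ 2`, `Dₙ` and `Dₙ*` for `n ≥ 3`, the split `Bₙ` for `n ≥ 3`, and `E₆`, `E₇`, `E₈`. -/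
def IsNonCartesianRootLattice (Λ : Submodule ℤ E) : Prop :=
  (∃ n : ℕ, 2 ≤ n ∧ HasGramMatrix (CartanMatrix.A n) Λ) ∨
  (∃ n : ℕ, 2 ≤ n ∧ IsDualOfGramMatrix (CartanMatrix.A n) Λ) ∨
  (∃ n : ℕ, 3 ≤ n ∧ HasGramMatrix (CartanMatrix.D n) Λ) ∨
  (∃ n : ℕ, 3 ≤ n ∧ IsDualOfGramMatrix (CartanMatrix.D n) Λ) ∨
  (∃ n : ℕ, 3 ≤ n ∧ IsSplitCubeLattice n Λ) ∨
  HasGramMatrix CartanMatrix.E₆ Λ ∨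
  HasGramMatrix CartanMatrix.E₇ Λ ∨
  HasGramMatrix CartanMatrix.E₈ Λ

variable [FiniteDimensional ℝ E] [MeasurableSpace E] [BorelSpace E]

/-- `voronoiSpline Λ k` is the `(k + 1)`-fold convolution of the indicator function of the Voronoi
cell of `Λ` with itself; for `k = 0` it is the indicator function. -/
def voronoiSpline (Λ : Submodule ℤ E) : ℕ → E → ℝ
  | 0 => (voronoiCell Λ).indicator (fun _ => (1 : ℝ))
  | k + 1 => voronoiSpline Λ k ⋆[ContinuousLinearMap.mul ℝ ℝ, volume]
      (voronoiCell Λ).indicator (fun _ => (1 : ℝ))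

/-- The splines attached to the cells `t + h (v + V)`, `v ∈ Λ`, of the copy of the Voronoi
tessellation that is scaled by `h` and translated by `t`. -/
def scaledSplines (Λ : Submodule ℤ E) (k : ℕ) (h : ℝ) (t : E) : Set (E → ℝ) :=
  {g | ∃ v ∈ Λ, g = fun x => voronoiSpline Λ k (h⁻¹ • (x - t) - v)}

/-- The splines of order `k` on the Voronoi tessellation of `Λ` are refinable: for some finer
scaled copy of the tessellation, the spline of each cell is a linear combination of the splines of
the scaled copy. Functions are compared almost everywhere, so that the values on the cell
boundaries play no role. -/
def IsRefinable (Λ : Submodule ℤ E) (k : ℕ) : Prop :=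
  ∃ h : ℝ, 0 < h ∧ h < 1 ∧ ∃ t : E, ∀ v ∈ Λ,
    ∃ f ∈ Submodule.span ℝ (scaledSplines Λ k h t),
      (fun x => voronoiSpline Λ k (x - v)) =ᵐ[volume] f

end VoronoiSplines

/-! The Laplace transform of `M_K` is the `K`-th power of the Laplace transform `L` of the Voronoi
cell, and scaling or translating a spline rescales the argument and adds exponential factors.
Refinability therefore gives, along any direction `v`, a relation `L(s v)^K = P(s) L(h s v)^K` with
a real exponential sum `P` and `0 < h < 1` (`IsRefinable.cellLaplace_eq`).

Take for `v` a vector whose bisector carries a facet. Slicing the cell orthogonally to `v` turns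
`L(s v)`, up to a constant, an exponential factor and a rescaling of `s`, into `f(s) = ∫₀¹ exp(-s y)
A(y) dy`, where `A(y)` is the measure of the slice at relative depth `y` below the facet. The cell
and the facet are centrally symmetric, so by convexity the cell contains the orthogonal prism
between the facet and its opposite, whence `A ≥ A(0)`. If the cell is not equal to this prism, then
`A > A(0)` immediately below the facet.

The relation for `f` is then impossible (`not_laplace_refinement`). As `s f(s) → A(0) > 0`, the
normalized sum `Q = h^{-K} P` tends to `1`, and a convergent exponential sum converges exponentially
fast. Iterating the relation towards infinity bounds `s f(s) - A(0)` above by an exponentially small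
function. But the extra mass of `A - A(0)` near `0` makes `s f(s) - A(0)` decay more slowly than any
`exp(-δ s)`, a contradiction.

What remains is to see that the cell is no prism (`not_isRefinable_of_relevant`). It suffices to
have a facet vector `v`, a lattice vector `w` at an acute angle to `v`, and a point `x` of the cell
on the bisector of `w` but not on that of `v`: moving `x` along `v` up to the hyperplane of the
facet violates the inequality of `w`. Explicit `v`, `w`, `x` are found for even root lattices, for
`Aₙ*`, and for the centered cubic lattices, which cover both `Dₙ*` and the split `Bₙ`. -/

open Filter Topology

/-! ### Real exponential sums and their limits. -/

/-- Real exponential sums `s ↦ ∑ cᵢ exp (aᵢ s)`. -/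
def expSums : Submodule ℝ (ℝ → ℝ) :=
  Submodule.span ℝ (Set.range fun a s : ℝ => Real.exp (a * s))

theorem exp_mem_expSums (a : ℝ) : (fun s => Real.exp (a * s)) ∈ expSums :=
  Submodule.subset_span ⟨a, rfl⟩

theorem exp_mul_mem_expSums (b : ℝ) {P : ℝ → ℝ} (hP : P ∈ expSums) :
    (fun s => Real.exp (b * s) * P s) ∈ expSums := by
  induction hP using Submodule.span_induction with
  | mem x hx =>
    obtain ⟨a, rfl⟩ := hx
    convert exp_mem_expSums (b + a) using 2 with s
    rw [← Real.exp_add]; ring_nf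
  | zero =>
    convert expSums.zero_mem using 2 with s
    simp
  | add x y _ _ hx hy =>
    convert expSums.add_mem hx hy using 2 with s
    simp [mul_add]
  | smul c x _ hx =>
    convert expSums.smul_mem c hx using 2 with s
    simp; ring

theorem comp_mul_mem_expSums (b : ℝ) {P : ℝ → ℝ} (hP : P ∈ expSums) :
    (fun s => P (b * s)) ∈ expSums := by
  induction hP using Submodule.span_induction with
  | mem x hx =>
    obtain ⟨a, rfl⟩ := hx
    convert exp_mem_expSums (a * b) using 2 with s
    ring_nf
  | zero => exact expSums.zero_mem
  | add x y _ _ hx hy => exact expSums.add_mem hx hy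
  | smul c x _ hx => exact expSums.smul_mem c hx

theorem exists_exp_bound_of_neg (S : Finset ℝ) (c : ℝ → ℝ) (hS : ∀ b ∈ S, b < 0) :
    ∃ δ > 0, ∃ C ≥ 0, ∀ s ≥ 0, |∑ b ∈ S, c b * Real.exp (b * s)| ≤ C * Real.exp (-δ * s) := by
  classical
  induction S using Finset.induction_on with
  | empty => exact ⟨1, one_pos, 0, le_rfl, by simp⟩
  | insert a S ha ih =>
    obtain ⟨δ, hδ, C, hC, h⟩ := ih fun b hb => hS b (Finset.mem_insert_of_mem hb)
    have ha0 := hS a (Finset.mem_insert_self _ _)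
    refine ⟨min δ (-a), lt_min hδ (by linarith), |c a| + C, by positivity, fun s hs => ?_⟩
    rw [Finset.sum_insert ha]
    refine (abs_add_le _ _).trans ?_
    rw [abs_mul, Real.abs_exp, add_mul]
    have h1 : Real.exp (a * s) ≤ Real.exp (-min δ (-a) * s) := by
      gcongr; linarith [min_le_right δ (-a)]
    have h2 : Real.exp (-δ * s) ≤ Real.exp (-min δ (-a) * s) := by
      gcongr; exact min_le_left _ _
    exact add_le_add (by gcongr) ((h s hs).trans (by gcongr))


theorem tendsto_exp_mul_atTop_of_neg {a : ℝ} (ha : a < 0) :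
    Tendsto (fun s => Real.exp (a * s)) atTop (𝓝 0) :=
  Real.tendsto_exp_atBot.comp (tendsto_id.const_mul_atTop_of_neg ha)

theorem tendsto_sum_exp_of_nonpos (S : Finset ℝ) (c : ℝ → ℝ) {a : ℝ} (hS : ∀ b ∈ S, b ≤ a) :
    Tendsto (fun s => ∑ b ∈ S, c b * Real.exp ((b - a) * s)) atTop
      (𝓝 (∑ b ∈ S, if b = a then c b else 0)) := by
  refine tendsto_finsetSum _ fun b hb => ?_
  split_ifs with h
  · simp [h]
  · simpa using (tendsto_exp_mul_atTop_of_neg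
      (sub_neg.2 (lt_of_le_of_ne (hS b hb) h))).const_mul (c b)

/-- A convergent exponential sum converges exponentially fast. -/
theorem exists_exp_bound_of_tendsto {P : ℝ → ℝ} (hP : P ∈ expSums) {l : ℝ}
    (h : Tendsto P atTop (𝓝 l)) :
    ∃ δ > 0, ∃ C ≥ 0, ∀ s ≥ 0, |P s - l| ≤ C * Real.exp (-δ * s) := by
  obtain ⟨c, rfl⟩ := Finsupp.mem_span_range_iff_exists_finsupp.1 hP
  have hc : ∀ s, (c.sum fun i a => a • fun s : ℝ => Real.exp (i * s)) s =
      ∑ b ∈ c.support, c b * Real.exp (b * s) := fun s => by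
    simp [Finsupp.sum, Finset.sum_apply]
  simp only [hc]
  replace h : Tendsto (fun s => ∑ b ∈ c.support, c b * Real.exp (b * s)) atTop (𝓝 l) :=
    h.congr hc
  -- If the largest exponent `a` were positive, multiplying by `exp (-a s)` would send the sum both
  -- to the nonzero coefficient of `a` and, by convergence, to `0`.
  have hneg : ∀ b ∈ c.support, b ≤ 0 := by
    by_contra! hcon
    obtain ⟨b, hb, hb0⟩ := hcon
    have hne : c.support.Nonempty := ⟨b, hb⟩
    set a := c.support.max' hne
    have ha : 0 < a := hb0.trans_le (Finset.le_max' _ _ hb)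
    have h1 := tendsto_sum_exp_of_nonpos c.support c (a := a) fun b hb => Finset.le_max' _ _ hb
    have h2 := h.mul (tendsto_exp_mul_atTop_of_neg (neg_lt_zero.2 ha))
    have h3 := tendsto_nhds_unique (h1.congr fun s => ?_) h2
    · have hm := c.support.max'_mem hne
      rw [Finset.sum_ite_eq' c.support a, if_pos hm, mul_zero] at h3
      exact Finsupp.mem_support_iff.1 hm h3
    · rw [Finset.sum_mul]
      refine Finset.sum_congr rfl fun b _ => ?_
      rw [mul_assoc, ← Real.exp_add]; ring_nf
  have h1 := tendsto_sum_exp_of_nonpos c.support c hneg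
  simp only [sub_zero] at h1
  have hl := tendsto_nhds_unique h h1
  obtain ⟨δ, hδ, C, hC, hb⟩ := exists_exp_bound_of_neg (c.support.filter (· ≠ 0)) c fun b hb => by
    rw [Finset.mem_filter] at hb
    exact lt_of_le_of_ne (hneg b hb.1) hb.2
  refine ⟨δ, hδ, C, hC, fun s hs => ?_⟩
  convert hb s hs using 2
  rw [hl, ← Finset.sum_sub_distrib, Finset.sum_filter]
  refine Finset.sum_congr rfl fun b _ => ?_
  by_cases hb : b = 0 <;> simp [hb]

/-! ### Asymptotics of Laplace transforms on the unit interval. -/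

/-- A function `G` tending to `0` with `G (h s) ≤ G s + O(exp (-δ s))`, where `0 < h < 1`, is
bounded above by an exponentially small function. -/
theorem exists_exp_bound_of_scaling {G : ℝ → ℝ} {h δ C s₀ : ℝ} (h0 : 0 < h) (h1 : h < 1)
    (hδ : 0 < δ) (hC : 0 ≤ C) (hG : Tendsto G atTop (𝓝 0))
    (hle : ∀ s ≥ s₀, G (h * s) ≤ G s + C * Real.exp (-δ * s)) :
    ∃ δ' > 0, ∃ B, ∀ᶠ s in atTop, G s ≤ B * Real.exp (-δ' * s) := by
  have hh : δ < δ / h := by rw [lt_div_iff₀ h0]; nlinarith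
  refine ⟨δ / h, hδ.trans hh, 2 * C, ?_⟩
  have hlim : Tendsto (fun s => 2 * Real.exp ((δ - δ / h) * s)) atTop (𝓝 (2 * 0)) :=
    (tendsto_exp_mul_atTop_of_neg (by linarith)).const_mul 2
  obtain ⟨s₁, hs₁⟩ := eventually_atTop.1 (hlim.eventually_le_const (u := 1) (by norm_num))
  -- The correction term at `h * s` is `2 C exp (-δ s)`: it absorbs the error and leaves `C exp (-δ
  -- s)` to spare, which dominates the correction at `s` for large `s`. Hence `H (h * s) ≤ H s`, so
  -- `H` increases along `h⁻¹ ^ n * s` to its limit `0` and is nonpositive.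
  set H : ℝ → ℝ := fun s => G s - 2 * C * Real.exp (-(δ / h) * s) with hH
  have hstep : ∀ s ≥ max s₀ s₁, H (h * s) ≤ H s := fun s hs => by
    have e1 := hle s ((le_max_left _ _).trans hs)
    have e2 := hs₁ s ((le_max_right _ _).trans hs)
    have e3 : Real.exp (-(δ / h) * (h * s)) = Real.exp (-δ * s) := by
      congr 1; field_simp
    have e4 : Real.exp (-(δ / h) * s) = Real.exp ((δ - δ / h) * s) * Real.exp (-δ * s) := by
      rw [← Real.exp_add]; ring_nf
    simp only [hH, e3, e4]
    have e5 : 0 ≤ C * Real.exp (-δ * s) := by positivity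
    nlinarith
  have hH0 : Tendsto H atTop (𝓝 0) := by
    simpa only [mul_zero, sub_zero] using hG.sub ((tendsto_exp_mul_atTop_of_neg
      (neg_lt_zero.2 (hδ.trans hh))).const_mul (2 * C))
  filter_upwards [eventually_ge_atTop (max 1 (max s₀ s₁))] with s hs
  have hs1 : 1 ≤ s := (le_max_left _ _).trans hs
  have hs2 : max s₀ s₁ ≤ s := (le_max_right _ _).trans hs
  have hi : 1 < h⁻¹ := (one_lt_inv₀ h0).2 h1
  have hmono : Monotone fun n : ℕ => H (h⁻¹ ^ n * s) := by
    refine monotone_nat_of_le_succ fun n => ?_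
    have := hstep (h⁻¹ ^ (n + 1) * s) (hs2.trans
      (le_mul_of_one_le_left (by linarith) (one_le_pow₀ hi.le)))
    have e : h * (h⁻¹ ^ (n + 1) * s) = h⁻¹ ^ n * s := by
      rw [pow_succ]; field_simp
    rwa [e] at this
  have ht : Tendsto (fun n : ℕ => H (h⁻¹ ^ n * s)) atTop (𝓝 0) :=
    hH0.comp ((tendsto_pow_atTop_atTop_of_one_lt hi).atTop_mul_const (by linarith))
  have := hmono.ge_of_tendsto ht 0
  simp only [pow_zero, one_mul, hH] at this
  linarith

theorem integrableOn_exp_mul_unit {A : ℝ → ℝ} {M : ℝ} (hA : Measurable A)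
    (hM : ∀ y, |A y| ≤ M) (s : ℝ) :
    IntegrableOn (fun y => Real.exp (-s * y) * A y) (Set.Ioc 0 1) := by
  refine IntegrableOn.mono_set ?_ Set.Ioc_subset_Icc_self
  have h1 : IntegrableOn (fun y => Real.exp (-s * y)) (Set.Icc (0 : ℝ) 1) :=
    (by fun_prop : Continuous fun y => Real.exp (-s * y)).continuousOn.integrableOn_Icc
  exact h1.mul_bdd hA.aestronglyMeasurable (ae_of_all _ hM)

theorem mul_integral_exp_unit (s : ℝ) :
    s * ∫ y in Set.Ioc (0 : ℝ) 1, Real.exp (-s * y) = 1 - Real.exp (-s) := by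
  have h := intervalIntegral.mul_integral_comp_mul_left (a := 0) (b := 1) (f := Real.exp) (-s)
  rw [intervalIntegral.integral_of_le zero_le_one, integral_exp] at h
  simp only [mul_zero, mul_one, Real.exp_zero] at h
  linarith

/-- If `B ≥ 0` on `(0, 1]` tends to `0` at `0⁺` then `s ∫ exp (-s y) B y → 0` as `s → ∞`. -/
theorem tendsto_mul_integral_exp_unit {B : ℝ → ℝ} {M : ℝ} (hB : Measurable B)
    (hM : ∀ y, |B y| ≤ M) (h0 : ∀ y ∈ Set.Ioc (0 : ℝ) 1, 0 ≤ B y)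
    (hlim : Tendsto B (𝓝[>] 0) (𝓝 0)) :
    Tendsto (fun s => s * ∫ y in Set.Ioc (0 : ℝ) 1, Real.exp (-s * y) * B y) atTop (𝓝 0) := by
  have hM0 : 0 ≤ M := (abs_nonneg _).trans (hM 0)
  refine tendsto_order.2 ⟨fun a ha => ?_, fun a ha => ?_⟩
  · filter_upwards [eventually_ge_atTop 0] with s hs
    refine ha.trans_le (mul_nonneg hs (setIntegral_nonneg measurableSet_Ioc fun y hy => ?_))
    exact mul_nonneg (Real.exp_pos _).le (h0 y hy)
  · have hev := hlim.eventually_lt_const (half_pos ha)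
    rw [eventually_nhdsWithin_iff, Metric.eventually_nhds_iff] at hev
    obtain ⟨η, hη, hsmall⟩ := hev
    have hdec : Tendsto (fun s => s * (M * Real.exp (-η * s))) atTop (𝓝 0) := by
      have h1 := (Real.tendsto_pow_mul_exp_neg_atTop_nhds_zero 1).comp
        (tendsto_id.const_mul_atTop hη)
      have h2 := h1.const_mul (M / η)
      rw [mul_zero] at h2
      refine h2.congr fun s => ?_
      simp only [Function.comp, id, pow_one, neg_mul]
      field_simp
    filter_upwards [hdec.eventually_lt_const (half_pos ha), eventually_gt_atTop 0] with s hs hs0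
    -- Below `η` the function `B` is less than `a / 2`; above `η` the exponential is at most `exp
    -- (-η s)`. The sum of both bounds is valid everywhere.
    have hle : ∫ y in Set.Ioc (0 : ℝ) 1, Real.exp (-s * y) * B y ≤
        ∫ y in Set.Ioc (0 : ℝ) 1, (Real.exp (-s * y) * (a / 2) + M * Real.exp (-η * s)) := by
      have hi := integrableOn_exp_mul_unit (A := fun _ => a / 2) measurable_const
        (fun _ => le_rfl) s
      refine setIntegral_mono_on (integrableOn_exp_mul_unit hB hM s)
        (hi.add (integrable_const _)) measurableSet_Ioc fun y hy => ?_
      rcases lt_or_ge y η with hyη | hyη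
      · have := hsmall (by simpa [abs_of_pos hy.1] using hyη) hy.1
        have h1 : Real.exp (-s * y) * B y ≤ Real.exp (-s * y) * (a / 2) := by gcongr
        have h2 : 0 ≤ M * Real.exp (-η * s) := by positivity
        linarith
      · have h1 : Real.exp (-s * y) * B y ≤ Real.exp (-η * s) * M := by
          refine mul_le_mul (Real.exp_le_exp.2 (by nlinarith)) ((le_abs_self _).trans (hM y))
            (h0 y hy) (Real.exp_pos _).le
        have h2 : 0 ≤ Real.exp (-s * y) * (a / 2) := by positivity
        linarith
    have hi := integrableOn_exp_mul_unit (A := fun _ => a / 2) measurable_const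
        (fun _ => le_rfl) s
    rw [integral_add hi (integrable_const _), integral_mul_const] at hle
    simp only [integral_const, MeasurableSet.univ, measureReal_restrict_apply, Set.univ_inter,
      Real.volume_real_Ioc, sub_zero, smul_eq_mul] at hle
    have h3 := mul_le_mul_of_nonneg_left hle hs0.le
    have h4 := mul_integral_exp_unit s
    have h5 : s * ((∫ y in Set.Ioc (0 : ℝ) 1, Real.exp (-s * y)) * (a / 2) +
        max 1 0 * (M * Real.exp (-η * s))) =
        (s * ∫ y in Set.Ioc (0 : ℝ) 1, Real.exp (-s * y)) * (a / 2) +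
          s * (M * Real.exp (-η * s)) := by
      rw [max_eq_left zero_le_one]; ring
    rw [h5, h4] at h3
    nlinarith [Real.exp_pos (-s)]

/-- The Laplace transform `f` of a function `A` on `(0, 1]` that starts at its minimum and
increases strictly there satisfies no relation `f(s)ᴷ = P(s) f(hs)ᴷ` with an exponential sum `P`. -/
theorem not_laplace_refinement {A : ℝ → ℝ} {M : ℝ} (hA : Measurable A) (hM : ∀ y, |A y| ≤ M)
    (hpos : 0 < A 0) (hge : ∀ y ∈ Set.Ioc (0 : ℝ) 1, A 0 ≤ A y)
    (hlim : Tendsto A (𝓝[>] 0) (𝓝 (A 0))) {y₁ : ℝ} (hy₁ : 0 < y₁)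
    (hgt : ∀ y ∈ Set.Ioc 0 y₁, A 0 < A y) {h : ℝ} (h0 : 0 < h) (h1 : h < 1) {K : ℕ} (hK : K ≠ 0)
    {P : ℝ → ℝ} (hP : P ∈ expSums) :
    ¬ ∀ s, (∫ y in Set.Ioc (0 : ℝ) 1, Real.exp (-s * y) * A y) ^ K =
      P s * (∫ y in Set.Ioc (0 : ℝ) 1, Real.exp (-(h * s) * y) * A y) ^ K := by
  intro heq
  set f : ℝ → ℝ := fun s => ∫ y in Set.Ioc (0 : ℝ) 1, Real.exp (-s * y) * A y with hf
  set D : ℝ → ℝ := fun s => ∫ y in Set.Ioc (0 : ℝ) 1, Real.exp (-s * y) * (A y - A 0) with hD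
  have hBm : Measurable fun y => A y - A 0 := hA.sub_const _
  have hBM : ∀ y, |A y - A 0| ≤ M + M := fun y =>
    (abs_sub _ _).trans (add_le_add (hM y) (hM 0))
  have hDint := integrableOn_exp_mul_unit hBm hBM
  have hfD : ∀ s, s * f s = s * D s + A 0 * (1 - Real.exp (-s)) := fun s => by
    have e : D s = f s - (∫ y in Set.Ioc (0 : ℝ) 1, Real.exp (-s * y)) * A 0 := by
      simp only [hD, hf, mul_sub]
      rw [integral_sub (integrableOn_exp_mul_unit hA hM s)
        (integrableOn_exp_mul_unit (A := fun _ => A 0) measurable_const (fun _ => le_rfl) s),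
        integral_mul_const]
    rw [e, ← mul_integral_exp_unit s]; ring
  have hexp0 : Tendsto (fun s : ℝ => Real.exp (-s)) atTop (𝓝 0) :=
    Real.tendsto_exp_neg_atTop_nhds_zero
  have hG0 : Tendsto (fun s => s * f s - A 0) atTop (𝓝 0) := by
    have hD0 := tendsto_mul_integral_exp_unit hBm hBM (fun y hy => sub_nonneg.2 (hge y hy))
      (by simpa using hlim.sub_const (A 0))
    have := hD0.sub (hexp0.const_mul (A 0))
    simp only [mul_zero, sub_zero] at this
    refine this.congr fun s => ?_
    rw [hfD]; ring
  have hg : Tendsto (fun s => s * f s) atTop (𝓝 (A 0)) := by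
    simpa using hG0.add_const (A 0)
  have hhs : Tendsto (fun s => h * s) atTop atTop := tendsto_id.const_mul_atTop h0
  have hg' : Tendsto (fun s => h * s * f (h * s)) atTop (𝓝 (A 0)) := hg.comp hhs
  -- the normalized relation
  set Q : ℝ → ℝ := (h⁻¹ ^ K) • P with hQdef
  have hQ : Q ∈ expSums := expSums.smul_mem _ hP
  have hrel : ∀ s, (s * f s) ^ K = Q s * (h * s * f (h * s)) ^ K := fun s => by
    have e := heq s
    change f s ^ K = P s * f (h * s) ^ K at e
    simp only [hQdef, Pi.smul_apply, smul_eq_mul, mul_pow, e, inv_pow]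
    field_simp
  have hQ1 : Tendsto Q atTop (𝓝 1) := by
    have h2 := (hg.pow K).div (hg'.pow K) (pow_ne_zero _ hpos.ne')
    rw [div_self (pow_ne_zero _ hpos.ne')] at h2
    refine h2.congr' ?_
    filter_upwards [hg'.eventually_ne hpos.ne'] with s hs
    rw [Pi.div_apply, hrel s, mul_div_cancel_right₀ _ (pow_ne_zero _ hs)]
  obtain ⟨δ, hδ, C, hC, hCb⟩ := exists_exp_bound_of_tendsto hQ hQ1
  have hstep : ∀ᶠ s in atTop, h * s * f (h * s) - A 0 ≤
      (s * f s - A 0) + C * (2 * A 0) * Real.exp (-δ * s) := by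
    filter_upwards [hg.eventually_const_lt hpos, hg'.eventually_const_lt hpos,
      hg'.eventually_lt_const (show A 0 < 2 * A 0 by linarith), eventually_ge_atTop 0]
      with s hs1 hs2 hs3 hs4
    set a := s * f s
    set b := h * s * f (h * s)
    have hE : 0 ≤ C * Real.exp (-δ * s) := by positivity
    rcases le_or_gt b a with hba | hba
    · nlinarith
    -- Since `0 < a / b < 1`, the power is at most the base. This removes `K` without extracting
    -- roots: `a / b ≥ Q s ≥ 1 - C exp (-δ s)`, and `b < 2 * A 0` makes the error absolute.
    · have e1 : (a / b) ^ K = Q s := by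
        rw [div_pow, hrel s, mul_div_cancel_right₀ _ (pow_ne_zero _ hs2.ne')]
      have e2 : (a / b) ^ K ≤ a / b :=
        pow_le_of_le_one (by positivity) ((div_le_one hs2).2 hba.le) hK
      have e3 := (abs_le.1 (hCb s hs4)).1
      have e4 : 1 - C * Real.exp (-δ * s) ≤ a / b := by linarith
      rw [le_div_iff₀ hs2] at e4
      nlinarith
  obtain ⟨s₀, hs₀⟩ := eventually_atTop.1 hstep
  obtain ⟨δ', hδ', B, hB⟩ := exists_exp_bound_of_scaling h0 h1 hδ (by positivity) hG0 hs₀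
  -- the lower bound
  set ε := min (min δ' y₁) 1 with hε
  have hε0 : 0 < ε := lt_min (lt_min hδ' hy₁) one_pos
  have hε1 : ε ≤ 1 := min_le_right _ _
  have hεδ : ε ≤ δ' := (min_le_left _ _).trans (min_le_left _ _)
  have hεy : ε ≤ y₁ := (min_le_left _ _).trans (min_le_right _ _)
  set c := ∫ y in Set.Ioc 0 ε, (A y - A 0) with hc
  have hBint : IntegrableOn (fun y => A y - A 0) (Set.Ioc 0 ε) := by
    have := (hDint 0).mono_set (Set.Ioc_subset_Ioc_right hε1)
    simpa using this
  have hcpos : 0 < c := by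
    refine (setIntegral_pos_iff_support_of_nonneg_ae ?_ hBint).2 ?_
    · exact (ae_restrict_iff' measurableSet_Ioc).2 (ae_of_all _ fun y hy =>
        sub_nonneg.2 (hge y ⟨hy.1, hy.2.trans hε1⟩))
    · have hsub : Set.Ioc 0 ε ⊆ (Function.support fun y => A y - A 0) ∩ Set.Ioc 0 ε :=
        fun y hy => ⟨(sub_pos.2 (hgt y ⟨hy.1, hy.2.trans hεy⟩)).ne', hy⟩
      exact (by simpa using hε0 : 0 < volume (Set.Ioc 0 ε)).trans_le (measure_mono hsub)
  have hlow : ∀ s ≥ 0, Real.exp (-ε * s) * c ≤ D s := fun s hs => by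
    calc Real.exp (-ε * s) * c = ∫ y in Set.Ioc 0 ε, Real.exp (-ε * s) * (A y - A 0) :=
          (integral_const_mul _ _).symm
      _ ≤ ∫ y in Set.Ioc 0 ε, Real.exp (-s * y) * (A y - A 0) := by
          refine setIntegral_mono_on (hBint.const_mul _)
            ((hDint s).mono_set (Set.Ioc_subset_Ioc_right hε1)) measurableSet_Ioc fun y hy => ?_
          refine mul_le_mul_of_nonneg_right (Real.exp_le_exp.2 ?_)
            (sub_nonneg.2 (hge y ⟨hy.1, hy.2.trans hε1⟩))
          nlinarith [hy.2]
      _ ≤ D s := by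
          refine setIntegral_mono_set (hDint s) ?_
            (Set.Ioc_subset_Ioc_right hε1).eventuallyLE
          exact (ae_restrict_iff' measurableSet_Ioc).2 (ae_of_all _ fun y hy =>
            mul_nonneg (Real.exp_pos _).le (sub_nonneg.2 (hge y hy)))
  -- The choice of `ε` lets `exp (-ε s)` dominate both `exp (-δ' s)` and `exp (-s)`, so it cancels.
  -- The factor `s` left over from `s * D s` gives the contradiction.
  have hfin : ∀ᶠ s in atTop, s * c ≤ |B| + A 0 := by
    filter_upwards [hB, eventually_ge_atTop 0] with s hs hs0
    have e1 := mul_le_mul_of_nonneg_left (hlow s hs0) hs0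
    have e2 := hfD s
    have e3 : Real.exp (-δ' * s) ≤ Real.exp (-ε * s) := Real.exp_le_exp.2 (by nlinarith)
    have e4 : Real.exp (-s) ≤ Real.exp (-ε * s) := Real.exp_le_exp.2 (by nlinarith)
    have e5 : B * Real.exp (-δ' * s) ≤ |B| * Real.exp (-ε * s) :=
      mul_le_mul (le_abs_self B) e3 (Real.exp_pos _).le (abs_nonneg _)
    have e6 : A 0 * Real.exp (-s) ≤ A 0 * Real.exp (-ε * s) := by gcongr
    have e7 : s * c * Real.exp (-ε * s) ≤ (|B| + A 0) * Real.exp (-ε * s) := by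
      linarith
    exact le_of_mul_le_mul_right e7 (Real.exp_pos _)
  obtain ⟨s, hs1, hs2⟩ := (hfin.and
    ((tendsto_id.atTop_mul_const hcpos).eventually_gt_atTop (|B| + A 0))).exists
  exact absurd hs1 (not_le.2 hs2)

/-! ### Laplace transforms of the cell and of its splines. -/

section Laplace

theorem isClosed_voronoiCell {E : Type*} [NormedAddCommGroup E] (Λ : Submodule ℤ E) : IsClosed (voronoiCell Λ) := by
  simp only [voronoiCell, Set.ofPred_forall]
  exact isClosed_iInter fun v => isClosed_iInter fun _ =>
    isClosed_le continuous_norm (continuous_id.sub continuous_const).norm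

variable {E : Type*} [NormedAddCommGroup E] [InnerProductSpace ℝ E]

theorem exp_mul_indicator_voronoiCell (Λ : Submodule ℤ E) (ξ : E) :
    (fun x => Real.exp (inner ℝ ξ x) * (voronoiCell Λ).indicator (fun _ => (1 : ℝ)) x) =
      (voronoiCell Λ).indicator fun x => Real.exp (inner ℝ ξ x) := by
  ext x
  by_cases hx : x ∈ voronoiCell Λ <;> simp [hx]

variable [FiniteDimensional ℝ E] [MeasurableSpace E] [BorelSpace E]

/-- The Laplace transform of the Voronoi cell. -/
noncomputable def cellLaplace (Λ : Submodule ℤ E) (ξ : E) : ℝ :=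
  ∫ x in voronoiCell Λ, Real.exp (inner ℝ ξ x)

theorem integrableOn_exp_inner_voronoiCell {Λ : Submodule ℤ E}
    (hb : Bornology.IsBounded (voronoiCell Λ)) (ξ : E) :
    IntegrableOn (fun x => Real.exp (inner ℝ ξ x)) (voronoiCell Λ) :=
  (by fun_prop : Continuous fun x => Real.exp (inner ℝ ξ x)).continuousOn.integrableOn_compact
    (Metric.isCompact_of_isClosed_isBounded (isClosed_voronoiCell Λ) hb)

/-- The exponential is a character of `E`, so weighting by it commutes with convolution; the Laplace
transform of a convolution can then be read off from the integral of a convolution. -/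
theorem exp_mul_convolution (f g : E → ℝ) (ξ : E) :
    (fun x => Real.exp (inner ℝ ξ x) *
      (f ⋆[ContinuousLinearMap.mul ℝ ℝ, volume] g) x) =
      (fun x => Real.exp (inner ℝ ξ x) * f x) ⋆[ContinuousLinearMap.mul ℝ ℝ, volume]
        (fun x => Real.exp (inner ℝ ξ x) * g x) := by
  ext x
  simp only [convolution_def, ContinuousLinearMap.mul_apply', ← integral_const_mul]
  refine integral_congr_ae (ae_of_all _ fun t => ?_)
  have : Real.exp (inner ℝ ξ x) = Real.exp (inner ℝ ξ t) * Real.exp (inner ℝ ξ (x - t)) := by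
    rw [← Real.exp_add, ← inner_add_right, add_sub_cancel]
  simp only [this]
  ring

theorem laplace_voronoiSpline {Λ : Submodule ℤ E} (hb : Bornology.IsBounded (voronoiCell Λ))
    (k : ℕ) (ξ : E) :
    Integrable (fun x => Real.exp (inner ℝ ξ x) * voronoiSpline Λ k x) ∧
      ∫ x, Real.exp (inner ℝ ξ x) * voronoiSpline Λ k x = cellLaplace Λ ξ ^ (k + 1) := by
  have hm := (isClosed_voronoiCell Λ).measurableSet
  have hi : Integrable
      (fun x => Real.exp (inner ℝ ξ x) * (voronoiCell Λ).indicator (fun _ => (1 : ℝ)) x) := by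
    rw [exp_mul_indicator_voronoiCell, integrable_indicator_iff hm]
    exact integrableOn_exp_inner_voronoiCell hb ξ
  have he : ∫ x, Real.exp (inner ℝ ξ x) * (voronoiCell Λ).indicator (fun _ => (1 : ℝ)) x =
      cellLaplace Λ ξ := by
    rw [exp_mul_indicator_voronoiCell, integral_indicator hm, cellLaplace]
  induction k with
  | zero => exact ⟨hi, by simpa [voronoiSpline] using he⟩
  | succ k ih =>
    simp only [voronoiSpline, exp_mul_convolution]
    refine ⟨ih.1.integrable_convolution _ hi, ?_⟩
    rw [integral_convolution _ ih.1 hi, ih.2, he, ContinuousLinearMap.mul_apply', ← pow_succ]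

/-- The change of variables `x = t + h (y + w)` in an integral. -/
theorem integral_comp_scale_translate (F : E → ℝ) {h : ℝ} (hh : 0 < h) (t w : E) :
    ∫ x, F (h⁻¹ • (x - t) - w) = h ^ Module.finrank ℝ E * ∫ y, F y := by
  rw [integral_sub_right_eq_self (fun x => F (h⁻¹ • x - w)) t,
    Measure.integral_comp_inv_smul_of_nonneg volume (fun x => F (x - w)) hh.le,
    integral_sub_right_eq_self F w, smul_eq_mul]

theorem integrable_comp_scale_translate {F : E → ℝ} (hF : Integrable F) {h : ℝ} (hh : 0 < h)
    (t w : E) : Integrable fun x => F (h⁻¹ • (x - t) - w) :=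
  (((hF.comp_sub_right w).comp_smul (inv_ne_zero hh.ne')).comp_sub_right t)

/-- Laplace transforms, along a line, of combinations of scaled splines. -/
theorem laplace_span_scaledSplines {Λ : Submodule ℤ E}
    (hb : Bornology.IsBounded (voronoiCell Λ)) (k : ℕ) {h : ℝ} (hh : 0 < h) (t v : E) {f : E → ℝ}
    (hf : f ∈ Submodule.span ℝ (scaledSplines Λ k h t)) :
    (∀ s : ℝ, Integrable fun x => Real.exp (inner ℝ (s • v) x) * f x) ∧
      ∃ P ∈ expSums, ∀ s : ℝ, ∫ x, Real.exp (inner ℝ (s • v) x) * f x =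
        P s * cellLaplace Λ ((h * s) • v) ^ (k + 1) := by
  induction hf using Submodule.span_induction with
  | mem g hg =>
    obtain ⟨w, -, rfl⟩ := hg
    have key : ∀ s : ℝ, (fun x => Real.exp (inner ℝ (s • v) x) *
        voronoiSpline Λ k (h⁻¹ • (x - t) - w)) = fun x =>
        Real.exp (inner ℝ v (t + h • w) * s) * (fun y => Real.exp (inner ℝ ((h * s) • v) y) *
          voronoiSpline Λ k y) (h⁻¹ • (x - t) - w) := fun s => by
      ext x
      simp only
      rw [← mul_assoc, ← Real.exp_add]
      congr 2
      simp only [inner_smul_left, inner_add_right, inner_sub_right, inner_smul_right,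
        RCLike.conj_to_real]
      field_simp
      ring
    refine ⟨fun s => ?_, _, expSums.smul_mem (h ^ Module.finrank ℝ E)
      (exp_mem_expSums (inner ℝ v (t + h • w))), fun s => ?_⟩
    · rw [key]
      exact (integrable_comp_scale_translate
        (laplace_voronoiSpline hb k ((h * s) • v)).1 hh t w).const_mul _
    · rw [key, integral_const_mul, integral_comp_scale_translate (fun y =>
        Real.exp (inner ℝ ((h * s) • v) y) * voronoiSpline Λ k y) hh,
        (laplace_voronoiSpline hb k ((h * s) • v)).2]
      simp only [Pi.smul_apply, smul_eq_mul]
      ring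
  | zero => exact ⟨fun s => by simp, 0, expSums.zero_mem, fun s => by simp⟩
  | add f g _ _ hf hg =>
    obtain ⟨hf1, P, hP, hf2⟩ := hf
    obtain ⟨hg1, Q, hQ, hg2⟩ := hg
    simp only [Pi.add_apply, mul_add]
    refine ⟨fun s => (hf1 s).add (hg1 s), P + Q, expSums.add_mem hP hQ, fun s => ?_⟩
    rw [integral_add (hf1 s) (hg1 s), hf2, hg2, Pi.add_apply, add_mul]
  | smul c f _ hf =>
    obtain ⟨hf1, P, hP, hf2⟩ := hf
    simp only [Pi.smul_apply, smul_eq_mul, mul_left_comm _ c]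
    refine ⟨fun s => (hf1 s).const_mul c, c • P, expSums.smul_mem c hP, fun s => ?_⟩
    rw [integral_const_mul, hf2, Pi.smul_apply, smul_eq_mul, mul_assoc]

/-- Refinability gives a functional equation for the Laplace transform of the cell. -/
theorem IsRefinable.cellLaplace_eq {Λ : Submodule ℤ E} {k : ℕ} (hr : IsRefinable Λ k)
    (hb : Bornology.IsBounded (voronoiCell Λ)) (v : E) :
    ∃ h : ℝ, 0 < h ∧ h < 1 ∧ ∃ P ∈ expSums, ∀ s : ℝ,
      cellLaplace Λ (s • v) ^ (k + 1) = P s * cellLaplace Λ ((h * s) • v) ^ (k + 1) := by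
  obtain ⟨h, h0, h1, t, H⟩ := hr
  -- The spline of the single cell at `0` already yields the relation.
  obtain ⟨f, hf, hae⟩ := H 0 Λ.zero_mem
  obtain ⟨-, P, hP, hfP⟩ := laplace_span_scaledSplines hb k h0 t v hf
  refine ⟨h, h0, h1, P, hP, fun s => ?_⟩
  rw [← hfP, ← (laplace_voronoiSpline hb k (s • v)).2]
  refine integral_congr_ae ?_
  filter_upwards [hae] with x hx
  rw [← hx, sub_zero]

end Laplace

/-! ### Slices of a convex body parallel to a symmetric facet. -/

section Slices

variable {E : Type*} [NormedAddCommGroup E] [InnerProductSpace ℝ E]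

/-- `V` is a centrally symmetric convex body with a centrally symmetric facet around `v / 2` that
is orthogonal to `v`. -/
structure IsSymmetricFacet (V : Set E) (v : E) : Prop where
  ne_zero : v ≠ 0
  isCompact : IsCompact V
  convex : Convex ℝ V
  neg_mem : ∀ x ∈ V, -x ∈ V
  inner_le : ∀ x ∈ V, inner ℝ v x ≤ ‖v‖ ^ 2 / 2
  facet_symm : ∀ x ∈ V, inner ℝ v x = ‖v‖ ^ 2 / 2 → v - x ∈ V
  exists_ball : ∃ ρ > 0, ∀ z, inner ℝ v z = 0 → ‖z‖ < ρ → (1 / 2 : ℝ) • v + z ∈ V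

/-- The slice of `V` orthogonal to `v` at the height `1 / 2 - y`, as a set of displacements. -/
def slice (V : Set E) (v : E) (y : ℝ) : Set (ℝ ∙ v)ᗮ :=
  {z | (1 / 2 - y) • v + (z : E) ∈ V}

theorem mem_slice {V : Set E} {v : E} {y : ℝ} {z : (ℝ ∙ v)ᗮ} :
    z ∈ slice V v y ↔ (1 / 2 - y) • v + (z : E) ∈ V := Iff.rfl

theorem inner_coe_orthogonal_singleton {v : E} (z : (ℝ ∙ v)ᗮ) : inner ℝ v (z : E) = 0 :=
  Submodule.mem_orthogonal_singleton_iff_inner_right.1 z.2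

theorem inner_smul_add_orthogonal {v : E} (a : ℝ) (z : (ℝ ∙ v)ᗮ) :
    inner ℝ v (a • v + (z : E)) = a * ‖v‖ ^ 2 := by
  rw [inner_add_right, inner_coe_orthogonal_singleton, inner_smul_right,
    real_inner_self_eq_norm_sq, add_zero]

theorem norm_le_norm_smul_add_orthogonal {v : E} (a : ℝ) (z : (ℝ ∙ v)ᗮ) :
    ‖z‖ ≤ ‖a • v + (z : E)‖ := by
  have h : inner ℝ (a • v) (z : E) = 0 := by
    rw [inner_smul_left, inner_coe_orthogonal_singleton, mul_zero]
  have := norm_add_sq_eq_norm_sq_add_norm_sq_real h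
  change ‖(z : E)‖ ≤ _
  nlinarith [norm_nonneg (a • v + (z : E)), norm_nonneg (z : E), norm_nonneg (a • v)]

namespace IsSymmetricFacet

variable {V : Set E} {v : E}

theorem norm_sq_pos (hV : IsSymmetricFacet V v) : 0 < ‖v‖ ^ 2 := by
  have := norm_pos_iff.2 hV.ne_zero
  positivity

/-- The symmetry of the facet followed by that of `V` carries the facet point `v / 2 + z` to `-v / 2
+ z`; the segment between them lies in `V` and meets every intermediate height over the same `z`. -/
theorem slice_zero_subset (hV : IsSymmetricFacet V v) {y : ℝ} (hy : y ∈ Set.Icc (0 : ℝ) 1) :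
    slice V v 0 ⊆ slice V v y := by
  intro z hz
  rw [mem_slice, sub_zero] at hz
  have h1 := hV.neg_mem _ (hV.facet_symm _ hz (by rw [inner_smul_add_orthogonal]; ring))
  have h2 := hV.convex hz h1 (sub_nonneg.2 hy.2) hy.1 (by ring)
  rw [mem_slice]
  convert h2 using 1
  module

theorem slice_eq_empty (hV : IsSymmetricFacet V v) {y : ℝ} (hy : y ∉ Set.Icc (0 : ℝ) 1) :
    slice V v y = ∅ := by
  refine Set.eq_empty_of_forall_notMem fun z hz => hy ?_
  have h1 := hV.inner_le _ hz
  have h2 := hV.inner_le _ (hV.neg_mem _ hz)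
  rw [inner_neg_right] at h2
  rw [inner_smul_add_orthogonal] at h1 h2
  have := hV.norm_sq_pos
  constructor <;> nlinarith

theorem convex_slice (hV : IsSymmetricFacet V v) (y : ℝ) : Convex ℝ (slice V v y) := by
  intro z hz w hw a b ha hb hab
  have := hV.convex hz hw ha hb hab
  rw [mem_slice]
  convert this using 1
  obtain rfl : b = 1 - a := by linarith
  push_cast
  module

theorem isClosed_preimage (hV : IsSymmetricFacet V v) :
    IsClosed {p : ℝ × (ℝ ∙ v)ᗮ | p.2 ∈ slice V v p.1} :=
  hV.isCompact.isClosed.preimage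
    (f := fun p : ℝ × (ℝ ∙ v)ᗮ => (1 / 2 - p.1) • v + (p.2 : E)) (by fun_prop)

theorem isClosed_slice (hV : IsSymmetricFacet V v) (y : ℝ) : IsClosed (slice V v y) :=
  hV.isClosed_preimage.preimage (f := fun z => (y, z)) (by fun_prop)

theorem exists_slice_subset_closedBall (hV : IsSymmetricFacet V v) :
    ∃ R, ∀ y, slice V v y ⊆ Metric.closedBall 0 R := by
  obtain ⟨R, hR⟩ := hV.isCompact.isBounded.subset_closedBall 0
  refine ⟨R, fun y z hz => ?_⟩
  have := hR hz
  rw [mem_closedBall_zero_iff] at this ⊢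
  exact (norm_le_norm_smul_add_orthogonal _ z).trans this

theorem exists_ball_subset_slice (hV : IsSymmetricFacet V v) :
    ∃ ρ > 0, Metric.ball 0 ρ ⊆ slice V v 0 := by
  obtain ⟨ρ, hρ, h⟩ := hV.exists_ball
  refine ⟨ρ, hρ, fun z hz => ?_⟩
  rw [mem_slice, sub_zero]
  exact h z (inner_coe_orthogonal_singleton z) (by simpa using hz)

/-- If `V` is not contained in the orthogonal prism over the facet, then the slices near the facet
contain points that do not project into the facet. -/
theorem exists_mem_slice_notMem (hV : IsSymmetricFacet V v) {y₁ : ℝ} {z₁ : (ℝ ∙ v)ᗮ}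
    (hz₁ : z₁ ∈ slice V v y₁) (hz₀ : z₁ ∉ slice V v 0) :
    0 < y₁ ∧ ∀ y ∈ Set.Ioc 0 y₁, ∃ z ∈ slice V v y, z ∉ slice V v 0 := by
  have hy₁ : y₁ ∈ Set.Icc (0 : ℝ) 1 := by
    by_contra h
    rw [hV.slice_eq_empty h] at hz₁
    exact hz₁
  have hpos : 0 < y₁ := lt_of_le_of_ne hy₁.1 (by rintro rfl; exact hz₀ hz₁)
  refine ⟨hpos, fun y hy => ?_⟩
  obtain ⟨ρ, hρ, hball⟩ := hV.exists_ball_subset_slice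
  -- Let `τ • z₁` be the last point of the segment from `0` to `z₁` that lies in the facet. Joining
  -- it, at depth `0`, to `z₁`, at depth `y₁`, gives at each intermediate depth a point further
  -- along the ray, hence outside the facet.
  have hT : IsCompact (Set.Icc (0 : ℝ) 1 ∩ {τ | τ • z₁ ∈ slice V v 0}) :=
    isCompact_Icc.inter_right ((hV.isClosed_slice 0).preimage (by fun_prop))
  obtain ⟨τ, ⟨hτ, hτs⟩, hmax⟩ := hT.exists_isGreatest
    ⟨0, by simp, hball (by simpa using hρ)⟩
  have hτ1 : τ < 1 := lt_of_le_of_ne hτ.2 (by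
    rintro rfl
    exact hz₀ (by simpa using hτs))
  have ht0 : 0 < y / y₁ := div_pos hy.1 hpos
  have ht1 : y / y₁ ≤ 1 := (div_le_one hpos).2 hy.2
  refine ⟨(τ + y / y₁ * (1 - τ)) • z₁, ?_, fun hmem => ?_⟩
  · have := hV.convex hτs hz₁ (sub_nonneg.2 ht1) ht0.le (by ring)
    rw [mem_slice]
    convert this using 1
    have e : y = y / y₁ * y₁ := by field_simp
    generalize y / y₁ = t at *
    subst e
    push_cast
    module
  · have h2 : 0 < y / y₁ * (1 - τ) := mul_pos ht0 (sub_pos.2 hτ1)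
    have := hmax ⟨⟨by linarith [hτ.1], by nlinarith⟩, hmem⟩
    linarith

variable [FiniteDimensional ℝ E] [MeasurableSpace E] [BorelSpace E]

theorem measureReal_slice_mono (hV : IsSymmetricFacet V v) {y : ℝ}
    (hy : y ∈ Set.Icc (0 : ℝ) 1) :
    volume.real (slice V v 0) ≤ volume.real (slice V v y) := by
  obtain ⟨R, hR⟩ := hV.exists_slice_subset_closedBall
  exact measureReal_mono (hV.slice_zero_subset hy)
    (measure_ne_top_of_subset (hR y) measure_closedBall_lt_top.ne)

theorem measureReal_slice_pos (hV : IsSymmetricFacet V v) : 0 < volume.real (slice V v 0) := by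
  obtain ⟨R, hR⟩ := hV.exists_slice_subset_closedBall
  obtain ⟨ρ, hρ, hball⟩ := hV.exists_ball_subset_slice
  exact ENNReal.toReal_pos ((Metric.measure_ball_pos volume _ hρ).trans_le
    (measure_mono hball)).ne' (measure_ne_top_of_subset (hR 0) measure_closedBall_lt_top.ne)

/-- One extra point suffices: the larger slice is convex with nonempty interior, so `z` is a limit
of interior points, and the closedness of the facet leaves a nonempty open set of them outside it.
-/
theorem measureReal_slice_lt (hV : IsSymmetricFacet V v) {y : ℝ} (hy : y ∈ Set.Icc (0 : ℝ) 1)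
    {z : (ℝ ∙ v)ᗮ} (hz : z ∈ slice V v y) (hz₀ : z ∉ slice V v 0) :
    volume.real (slice V v 0) < volume.real (slice V v y) := by
  obtain ⟨R, hR⟩ := hV.exists_slice_subset_closedBall
  obtain ⟨ρ, hρ, hball⟩ := hV.exists_ball_subset_slice
  have hint : (0 : (ℝ ∙ v)ᗮ) ∈ interior (slice V v y) :=
    mem_interior.2 ⟨_, hball.trans (hV.slice_zero_subset hy), Metric.isOpen_ball,
      Metric.mem_ball_self hρ⟩
  set O := (slice V v 0)ᶜ ∩ interior (slice V v y) with hO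
  have hOo : IsOpen O := (hV.isClosed_slice 0).isOpen_compl.inter isOpen_interior
  have hOn : O.Nonempty := by
    have hcl : z ∈ closure (interior (slice V v y)) := by
      rw [(hV.convex_slice y).closure_interior_eq_closure_of_nonempty_interior ⟨0, hint⟩]
      exact subset_closure hz
    exact mem_closure_iff.1 hcl _ (hV.isClosed_slice 0).isOpen_compl hz₀
  have hfin : ∀ y, volume (slice V v y) ≠ ⊤ := fun y =>
    measure_ne_top_of_subset (hR y) measure_closedBall_lt_top.ne
  have hOs : O ⊆ slice V v y := Set.inter_subset_right.trans interior_subset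
  have hOfin : volume O ≠ ⊤ := measure_ne_top_of_subset hOs (hfin y)
  have hpos : 0 < volume.real O := ENNReal.toReal_pos (hOo.measure_pos volume hOn).ne' hOfin
  have hdis : Disjoint (slice V v 0) O :=
    Set.disjoint_left.2 fun w hw hwO => hwO.1 hw
  have h1 := measureReal_union (μ := volume) hdis hOo.measurableSet (hfin 0) hOfin
  have h2 : volume.real (slice V v 0 ∪ O) ≤ volume.real (slice V v y) :=
    measureReal_mono (Set.union_subset (hV.slice_zero_subset hy) hOs) (hfin y)
  linarith

/-- Dominated convergence: over a facet point the indicators are constant for small `y`, and over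
any other point they vanish eventually because `V` is closed. -/
theorem tendsto_measureReal_slice (hV : IsSymmetricFacet V v) :
    Tendsto (fun y => volume.real (slice V v y)) (𝓝[>] 0) (𝓝 (volume.real (slice V v 0))) := by
  obtain ⟨R, hR⟩ := hV.exists_slice_subset_closedBall
  have hA : ∀ y, volume.real (slice V v y) = ∫ z, (slice V v y).indicator (fun _ => (1 : ℝ)) z :=
    fun y => by
      rw [integral_indicator (hV.isClosed_slice y).measurableSet]; simp
  simp only [hA]
  refine tendsto_integral_filter_of_dominated_convergence
    ((Metric.closedBall 0 R).indicator fun _ => (1 : ℝ)) ?_ ?_ ?_ ?_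
  · exact Eventually.of_forall fun y =>
      (measurable_const.indicator (hV.isClosed_slice y).measurableSet).aestronglyMeasurable
  · refine Eventually.of_forall fun y => ae_of_all _ fun z => ?_
    rw [Real.norm_of_nonneg (Set.indicator_nonneg (fun _ _ => zero_le_one) _)]
    exact Set.indicator_le_indicator_of_subset (hR y) (fun _ => zero_le_one) z
  · exact (integrable_indicator_iff Metric.isClosed_closedBall.measurableSet).2
      (integrableOn_const measure_closedBall_lt_top.ne)
  · refine ae_of_all _ fun z => tendsto_const_nhds.congr' ?_
    by_cases hz : z ∈ slice V v 0
    · filter_upwards [Ioc_mem_nhdsGT zero_lt_one] with y hy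
      rw [Set.indicator_of_mem hz,
        Set.indicator_of_mem (hV.slice_zero_subset (Set.Ioc_subset_Icc_self hy) hz)]
    · have hcl : IsClosed {y | z ∈ slice V v y} :=
        hV.isClosed_preimage.preimage (f := fun y => (y, z)) (by fun_prop)
      filter_upwards [nhdsWithin_le_nhds (hcl.isOpen_compl.mem_nhds hz)] with y hy
      rw [Set.indicator_of_notMem hz,
        Set.indicator_of_notMem (show z ∉ slice V v y from hy)]

theorem measurable_measureReal_slice (hV : IsSymmetricFacet V v) :
    Measurable fun y => volume.real (slice V v y) :=
  (measurable_measure_prodMk_left hV.isClosed_preimage.measurableSet).ennreal_toReal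

end IsSymmetricFacet

end Slices

/-! ### A cell that is not a prism has no refinable splines. -/

section KeyTheorem

variable {E : Type*} [NormedAddCommGroup E] [InnerProductSpace ℝ E] [FiniteDimensional ℝ E]
  [MeasurableSpace E] [BorelSpace E]

/-- Integration in the coordinates `x = a v + z` with `z` orthogonal to `v`. -/
theorem exists_integral_eq_integral_smul_add_orthogonal {v : E} (hv : v ≠ 0) :
    ∃ c : ℝ, 0 < c ∧ ∀ F : E → ℝ, Integrable F →
      ∫ x, F x = c * ∫ a : ℝ, ∫ z : (ℝ ∙ v)ᗮ, F (a • v + z) := by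
  let L : (ℝ × (ℝ ∙ v)ᗮ) ≃L[ℝ] E :=
    ((LinearEquiv.prodCongr (LinearEquiv.toSpanNonzeroSingleton ℝ E v hv)
      (LinearEquiv.refl ℝ (ℝ ∙ v)ᗮ)).trans
      (Submodule.prodEquivOfIsCompl _ _ (Submodule.isCompl_orthogonal _))).toContinuousLinearEquiv
  have hL : ∀ p, L p = p.1 • v + (p.2 : E) := fun p => by simp [L]
  let μ : Measure (ℝ × (ℝ ∙ v)ᗮ) := (volume : Measure ℝ).prod volume
  have hμ : (μ.map L).IsAddHaarMeasure := L.isAddHaarMeasure_map μ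
  -- Uniqueness of Haar measure provides the Jacobian; only its positivity matters, since it cancels
  -- from the relation.
  set c := Measure.addHaarScalarFactor (volume : Measure E) (μ.map L) with hc
  have hvol : (volume : Measure E) = c • μ.map L := Measure.isAddLeftInvariant_eq_smul _ _
  have hcpos : 0 < c := Measure.addHaarScalarFactor_pos_of_isAddHaarMeasure _ _
  have hLm : MeasurableEmbedding L := L.toHomeomorph.measurableEmbedding
  refine ⟨c, hcpos, fun F hF => ?_⟩
  have hF' : Integrable F (μ.map L) := by
    rw [hvol] at hF
    exact (integrable_smul_measure (c := (c : ENNReal)) (by exact_mod_cast hcpos.ne')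
      ENNReal.coe_ne_top).1 hF
  have hFL : Integrable (fun p : ℝ × (ℝ ∙ v)ᗮ => F (p.1 • v + (p.2 : E))) μ := by
    simpa only [Function.comp_def, hL] using hLm.integrable_map_iff.1 hF'
  calc ∫ x, F x = c * ∫ x, F x ∂(μ.map L) := by
        conv_lhs => rw [hvol, integral_smul_nnreal_measure]
        rfl
    _ = c * ∫ p, F (p.1 • v + (p.2 : E)) ∂μ := by
        rw [hLm.integral_map]; simp only [hL]
    _ = _ := by rw [integral_prod _ hFL]

/-- Fubini along `v`, with height `a = 1 / 2 - y`: outside `0 ≤ y ≤ 1` the slices are empty. -/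
theorem exists_cellLaplace_smul_eq {Λ : Submodule ℤ E} {v : E}
    (hV : IsSymmetricFacet (voronoiCell Λ) v) :
    ∃ c : ℝ, 0 < c ∧ ∀ s : ℝ, cellLaplace Λ (s • v) = c * (Real.exp (s * ‖v‖ ^ 2 / 2) *
      ∫ y in Set.Ioc (0 : ℝ) 1, Real.exp (-(s * ‖v‖ ^ 2) * y) *
        volume.real (slice (voronoiCell Λ) v y)) := by
  obtain ⟨c, hc, H⟩ := exists_integral_eq_integral_smul_add_orthogonal hV.ne_zero
  refine ⟨c, hc, fun s => ?_⟩
  set V := voronoiCell Λ with hVdef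
  have hVm : MeasurableSet V := hV.isCompact.measurableSet
  have hint := integrableOn_exp_inner_voronoiCell hV.isCompact.isBounded (s • v)
  rw [cellLaplace, ← integral_indicator hVm, H _ ((integrable_indicator_iff hVm).2 hint)]
  congr 1
  have hinner : ∀ a : ℝ, ∫ z : (ℝ ∙ v)ᗮ,
      V.indicator (fun x => Real.exp (inner ℝ (s • v) x)) (a • v + z) =
      Real.exp (s * ‖v‖ ^ 2 * a) * volume.real (slice V v (1 / 2 - a)) := fun a => by
    have e : (fun z : (ℝ ∙ v)ᗮ =>
        V.indicator (fun x => Real.exp (inner ℝ (s • v) x)) (a • v + z)) =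
        (slice V v (1 / 2 - a)).indicator fun _ => Real.exp (s * ‖v‖ ^ 2 * a) := by
      ext z
      have hm : z ∈ slice V v (1 / 2 - a) ↔ a • v + (z : E) ∈ V := by
        rw [mem_slice, sub_sub_cancel]
      by_cases hz : a • v + (z : E) ∈ V
      · rw [Set.indicator_of_mem hz, Set.indicator_of_mem (hm.2 hz), inner_smul_left,
          inner_smul_add_orthogonal]
        congr 1
        simp only [RCLike.conj_to_real]
        ring
      · rw [Set.indicator_of_notMem hz, Set.indicator_of_notMem (mt hm.1 hz)]
    rw [e, integral_indicator (hV.isClosed_slice _).measurableSet, setIntegral_const,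
      smul_eq_mul, mul_comm]
  simp only [hinner]
  rw [← integral_sub_left_eq_self _ volume (1 / 2 : ℝ), ← integral_const_mul,
    ← integral_Icc_eq_integral_Ioc]
  simp only [sub_sub_cancel]
  rw [setIntegral_eq_integral_of_forall_compl_eq_zero]
  · refine integral_congr_ae (ae_of_all _ fun y => ?_)
    simp only
    rw [← mul_assoc, ← Real.exp_add]
    ring_nf
  · intro y hy
    rw [hV.slice_eq_empty hy]
    simp

/-- If the Voronoi cell has a centrally symmetric facet and is not contained in the orthogonal prism
over this facet, then its splines are not refinable. -/
theorem not_isRefinable_of_isSymmetricFacet {Λ : Submodule ℤ E} {v : E}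
    (hV : IsSymmetricFacet (voronoiCell Λ) v) {x : E} (hx : x ∈ voronoiCell Λ)
    (hx' : x + (1 / 2 - inner ℝ v x / ‖v‖ ^ 2) • v ∉ voronoiCell Λ) (k : ℕ) :
    ¬ IsRefinable Λ k := by
  intro hr
  obtain ⟨h, h0, h1, P, hP, hrel⟩ := hr.cellLaplace_eq hV.isCompact.isBounded v
  obtain ⟨c, hc, hL⟩ := exists_cellLaplace_smul_eq hV
  have hN := hV.norm_sq_pos
  set N := ‖v‖ ^ 2 with hNdef
  set V := voronoiCell Λ
  have hzmem : x - (inner ℝ v x / N) • v ∈ (ℝ ∙ v)ᗮ := by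
    rw [Submodule.mem_orthogonal_singleton_iff_inner_right, inner_sub_right, inner_smul_right,
      real_inner_self_eq_norm_sq, ← hNdef]
    field_simp
    ring
  set z₁ : (ℝ ∙ v)ᗮ := ⟨_, hzmem⟩ with hz₁
  have hmem : z₁ ∈ slice V v (1 / 2 - inner ℝ v x / N) := by
    rw [mem_slice]
    convert hx using 1
    simp [hz₁]
  have hnot : z₁ ∉ slice V v 0 := by
    rw [mem_slice]
    convert hx' using 2
    simp only [hz₁]
    module
  obtain ⟨hy₁, hex⟩ := hV.exists_mem_slice_notMem hmem hnot
  obtain ⟨R, hR⟩ := hV.exists_slice_subset_closedBall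
  have hy₁1 : 1 / 2 - inner ℝ v x / N ≤ 1 := by
    by_contra hcon
    rw [hV.slice_eq_empty (fun h => hcon h.2)] at hmem
    exact hmem
  refine not_laplace_refinement (A := fun y => volume.real (slice V v y))
    (M := volume.real (Metric.closedBall (0 : (ℝ ∙ v)ᗮ) R)) hV.measurable_measureReal_slice
    (fun y => ?_) hV.measureReal_slice_pos
    (fun y hy => hV.measureReal_slice_mono (Set.Ioc_subset_Icc_self hy))
    hV.tendsto_measureReal_slice hy₁ (fun y hy => ?_) h0 h1 (Nat.succ_ne_zero k)
    -- Replacing `s` by `s / N` normalizes the exponents, and the quotient of the factors `exp (h s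
    -- / 2)` and `exp (s / 2)`, raised to the power `k + 1`, is absorbed into the exponential sum.
    (exp_mul_mem_expSums ((h - 1) * (k + 1) / 2) (comp_mul_mem_expSums N⁻¹ hP)) fun s => ?_
  · rw [abs_of_nonneg measureReal_nonneg]
    exact measureReal_mono (hR y) measure_closedBall_lt_top.ne
  · obtain ⟨z, hz, hz0⟩ := hex y hy
    exact hV.measureReal_slice_lt ⟨hy.1.le, hy.2.trans hy₁1⟩ hz hz0
  · have e := hrel (N⁻¹ * s)
    rw [hL, hL] at e
    have e1 : N⁻¹ * s * N = s := by field_simp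
    have e2 : h * (N⁻¹ * s) * N = h * s := by field_simp
    rw [e1, e2] at e
    simp only [mul_pow, ← Real.exp_nat_mul] at e
    have e3 : Real.exp ((h - 1) * (k + 1) / 2 * s) =
        Real.exp (((k + 1 : ℕ) : ℝ) * (h * s / 2)) / Real.exp (((k + 1 : ℕ) : ℝ) * (s / 2)) := by
      rw [← Real.exp_sub]; congr 1; push_cast; ring
    rw [Nat.succ_eq_add_one, e3]
    have hck : c ^ (k + 1) ≠ 0 := pow_ne_zero _ hc.ne'
    have hE := (Real.exp_pos (((k + 1 : ℕ) : ℝ) * (s / 2))).ne'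
    rw [div_mul_eq_mul_div, div_mul_eq_mul_div, eq_div_iff hE]
    refine mul_left_cancel₀ hck ?_
    linear_combination e

end KeyTheorem

/-! ### Voronoi-relevant vectors and the acute-angle criterion. -/

section RelevantVectors

variable {E : Type*} [NormedAddCommGroup E] [InnerProductSpace ℝ E]

theorem mem_voronoiCell_iff_inner {Λ : Submodule ℤ E} {x : E} :
    x ∈ voronoiCell Λ ↔ ∀ w ∈ Λ, 2 * inner ℝ x w ≤ ‖w‖ ^ 2 := by
  refine forall₂_congr fun w _ => ?_
  rw [← sq_le_sq₀ (norm_nonneg _) (norm_nonneg _), norm_sub_sq_real]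
  constructor <;> intro h <;> linarith

theorem convex_voronoiCell (Λ : Submodule ℤ E) : Convex ℝ (voronoiCell Λ) := by
  intro x hx y hy a b ha hb hab
  rw [mem_voronoiCell_iff_inner] at *
  intro w hw
  rw [inner_add_left, inner_smul_left, inner_smul_left]
  simp only [RCLike.conj_to_real]
  have h1 := mul_le_mul_of_nonneg_left (hx w hw) ha
  have h2 := mul_le_mul_of_nonneg_left (hy w hw) hb
  obtain rfl : b = 1 - a := by linarith
  nlinarith

theorem neg_mem_voronoiCell {Λ : Submodule ℤ E} {x : E} (hx : x ∈ voronoiCell Λ) :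
    -x ∈ voronoiCell Λ := by
  rw [mem_voronoiCell_iff_inner] at *
  intro w hw
  simpa using hx (-w) (Λ.neg_mem hw)

/-- On the bisector of `v`, the inequality of `v - w` at `x` is the inequality of `w` at `v - x`. -/
theorem sub_mem_voronoiCell {Λ : Submodule ℤ E} {v x : E} (hv : v ∈ Λ) (hx : x ∈ voronoiCell Λ)
    (hvx : inner ℝ v x = ‖v‖ ^ 2 / 2) : v - x ∈ voronoiCell Λ := by
  rw [mem_voronoiCell_iff_inner] at *
  intro w hw
  have h := hx (v - w) (Λ.sub_mem hv hw)
  rw [norm_sub_sq_real, inner_sub_right, real_inner_comm, hvx] at h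
  rw [inner_sub_left]
  linarith

variable [FiniteDimensional ℝ E]

/-- A vector is determined by its inner products with a basis. -/
noncomputable def innerCoordEquiv {ι : Type*} [Fintype ι] (b : Module.Basis ι ℝ E) :
    E ≃ₗ[ℝ] (ι → ℝ) :=
  (LinearMap.pi fun i => innerₗ E (b i)).linearEquivOfInjective (by
    rw [← LinearMap.ker_eq_bot, LinearMap.ker_eq_bot']
    intro x hx
    have h : (innerₗ E).flip x = 0 := b.ext fun i => congrFun hx i
    exact inner_self_eq_zero.1 (LinearMap.congr_fun h x))
    (by rw [Module.finrank_eq_card_basis b, Module.finrank_fintype_fun_eq_card])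

@[simp]
theorem innerCoordEquiv_apply {ι : Type*} [Fintype ι] (b : Module.Basis ι ℝ E) (x : E) (i : ι) :
    innerCoordEquiv b x i = inner ℝ (b i) x := by
  simp [innerCoordEquiv]

theorem isBounded_voronoiCell {ι : Type*} [Fintype ι] {Λ : Submodule ℤ E}
    (b : Module.Basis ι ℝ E) (hb : ∀ i, b i ∈ Λ) : Bornology.IsBounded (voronoiCell Λ) := by
  set T : E →ₗ[ℝ] (ι → ℝ) := (innerCoordEquiv b).toLinearMap with hTdef
  have hT : ∀ x i, T x i = inner ℝ (b i) x := innerCoordEquiv_apply b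
  obtain ⟨K, -, hK⟩ := T.exists_antilipschitzWith (innerCoordEquiv b).ker
  refine (hK.isBounded_preimage (s := Set.Icc (fun i => -(‖b i‖ ^ 2)) fun i => ‖b i‖ ^ 2)
    (Metric.isBounded_Icc _ _)).subset fun x hx => ?_
  have h1 := mem_voronoiCell_iff_inner.1 hx
  have h2 := mem_voronoiCell_iff_inner.1 (neg_mem_voronoiCell hx)
  refine ⟨fun i => ?_, fun i => ?_⟩ <;> simp only [hT] <;>
    have h3 := h1 _ (hb i) <;> have h4 := h2 _ (hb i) <;>
    rw [inner_neg_left] at h4 <;> rw [real_inner_comm] <;> nlinarith [sq_nonneg ‖b i‖]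

/-- Strict relevance says that `v / 2` satisfies every inequality other than those of `0` and `v`
strictly. The basis `b` serves boundedness of the cell, and `b'` serves discreteness of `Λ`, which
leaves finitely many inequalities to control near `v / 2`. -/
theorem isSymmetricFacet_voronoiCell {ι : Type*} [Fintype ι] {Λ : Submodule ℤ E}
    (b b' : Module.Basis ι ℝ E) (hb : ∀ i, b i ∈ Λ) (hb' : Λ ≤ Submodule.span ℤ (Set.range b'))
    {v : E} (hv : v ∈ Λ) (hv0 : v ≠ 0)
    (hrel : ∀ w ∈ Λ, w ≠ 0 → w ≠ v → inner ℝ v w < ‖w‖ ^ 2) :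
    IsSymmetricFacet (voronoiCell Λ) v where
  ne_zero := hv0
  isCompact := Metric.isCompact_of_isClosed_isBounded (isClosed_voronoiCell Λ)
    (isBounded_voronoiCell b hb)
  convex := convex_voronoiCell Λ
  neg_mem _ := neg_mem_voronoiCell
  inner_le x hx := by
    have := mem_voronoiCell_iff_inner.1 hx v hv
    rw [real_inner_comm] at this
    linarith
  facet_symm _ := sub_mem_voronoiCell hv
  exists_ball := by
    have hfin : {w | w ∈ Λ ∧ w ≠ 0 ∧ w ≠ v ∧ ‖w‖ ≤ ‖v‖ + 1}.Finite := by
      refine (ZSpan.setFinite_inter b' (Metric.isBounded_closedBall (x := (0 : E))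
        (r := ‖v‖ + 1))).subset fun w hw => ⟨?_, hb' hw.1⟩
      simpa using hw.2.2.2
    have hev : ∀ᶠ z in 𝓝 (0 : E), ∀ w ∈ {w | w ∈ Λ ∧ w ≠ 0 ∧ w ≠ v ∧ ‖w‖ ≤ ‖v‖ + 1},
        inner ℝ v w + 2 * inner ℝ z w < ‖w‖ ^ 2 := by
      rw [Filter.eventually_all_finite hfin]
      intro w hw
      have hc : Continuous fun z : E => inner ℝ v w + 2 * inner ℝ z w := by fun_prop
      refine hc.continuousAt.eventually_lt_const ?_
      simpa using hrel w hw.1 hw.2.1 hw.2.2.1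
    obtain ⟨ρ, hρ, hball⟩ := Metric.eventually_nhds_iff.1 hev
    refine ⟨min ρ (1 / 2), by positivity, fun z hz hzρ => ?_⟩
    rw [mem_voronoiCell_iff_inner]
    intro w hw
    rw [inner_add_left, inner_smul_left, RCLike.conj_to_real]
    rcases eq_or_ne w 0 with rfl | hw0
    · simp
    rcases eq_or_ne w v with rfl | hwv
    · rw [real_inner_self_eq_norm_sq, real_inner_comm, hz]
      linarith
    rcases le_or_gt ‖w‖ (‖v‖ + 1) with hle | hgt
    · have := hball (by simpa using hzρ.trans_le (min_le_left _ _)) w ⟨hw, hw0, hwv, hle⟩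
      linarith
    -- Long vectors need no finiteness: with `‖z‖ < 1 / 2`, Cauchy-Schwarz gives `⟪v, w⟫ + 2 ⟪z, w⟫
    -- ≤ (‖v‖ + 1) ‖w‖ < ‖w‖ ^ 2`.
    · have h1 := real_inner_le_norm v w
      have h2 := real_inner_le_norm z w
      have h3 := hzρ.trans_le (min_le_right _ _)
      nlinarith [norm_nonneg w, norm_nonneg z]

variable [MeasurableSpace E] [BorelSpace E]

/-- Non-refinability from a strictly Voronoi-relevant vector `v` and a point `x` of another facet,
not on the facet of `v`, such that the two facet normals form an acute angle. -/
theorem not_isRefinable_of_relevant {ι : Type*} [Fintype ι] {Λ : Submodule ℤ E}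
    (b b' : Module.Basis ι ℝ E) (hb : ∀ i, b i ∈ Λ) (hb' : Λ ≤ Submodule.span ℤ (Set.range b'))
    {v w x : E} (hv : v ∈ Λ) (hv0 : v ≠ 0)
    (hrel : ∀ u ∈ Λ, u ≠ 0 → u ≠ v → inner ℝ v u < ‖u‖ ^ 2) (hw : w ∈ Λ)
    (hx : ∀ u ∈ Λ, 2 * inner ℝ x u ≤ ‖u‖ ^ 2) (hxw : 2 * inner ℝ x w = ‖w‖ ^ 2)
    (hvw : 0 < inner ℝ v w) (hvx : 2 * inner ℝ v x < ‖v‖ ^ 2) (k : ℕ) :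
    ¬ IsRefinable Λ k := by
  refine not_isRefinable_of_isSymmetricFacet
    (isSymmetricFacet_voronoiCell b b' hb hb' hv hv0 hrel) (mem_voronoiCell_iff_inner.2 hx)
    (fun hmem => ?_) k
  -- The inequality of `w` is an equality at `x`, and the translation adds a positive multiple of
  -- `v`, on which `w` is positive.
  have h1 := mem_voronoiCell_iff_inner.1 hmem w hw
  have hN : 0 < ‖v‖ ^ 2 := by have := norm_pos_iff.2 hv0; positivity
  rw [inner_add_left, inner_smul_left, RCLike.conj_to_real] at h1
  have h2 : inner ℝ v x / ‖v‖ ^ 2 < 1 / 2 := by rw [div_lt_iff₀ hN]; linarith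
  nlinarith [mul_pos (sub_pos.2 h2) hvw]

/-! ### The root lattices `Aₙ`, `Dₙ`, `E₆`, `E₇`, `E₈`. -/

/-- Lattices spanned by a basis with an even Gram matrix of diagonal `2` that has an entry `-1`. -/
theorem HasGramMatrix.not_isRefinable {n : ℕ} {G : Matrix (Fin n) (Fin n) ℤ} {Λ : Submodule ℤ E}
    (hΛ : HasGramMatrix G Λ) (hdiag : ∀ i, G i i = 2) {i₀ j₀ : Fin n} (hneg : G i₀ j₀ = -1)
    (k : ℕ) : ¬ IsRefinable Λ k := by
  obtain ⟨r, hr, b, hG, rfl⟩ := hΛ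
  set Λ := Submodule.span ℤ (Set.range b)
  have hb : ∀ i, b i ∈ Λ := fun i => Submodule.subset_span ⟨i, rfl⟩
  have hbu : ∀ i, ∀ u ∈ Λ, ∃ m : ℤ, inner ℝ (b i) u = r * m := fun i u hu => by
    induction hu using Submodule.span_induction with
    | mem u hu => obtain ⟨j, rfl⟩ := hu; exact ⟨_, hG i j⟩
    | zero => exact ⟨0, by simp⟩
    | add u w _ _ hu hw =>
      obtain ⟨m, hm⟩ := hu
      obtain ⟨l, hl⟩ := hw
      exact ⟨m + l, by rw [inner_add_right, hm, hl]; push_cast; ring⟩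
    | smul a u _ hu =>
      obtain ⟨m, hm⟩ := hu
      refine ⟨a * m, ?_⟩
      rw [← Int.cast_smul_eq_zsmul ℝ, inner_smul_right, hm]; push_cast; ring
  have huw : ∀ u ∈ Λ, ∀ w ∈ Λ, ∃ m : ℤ, inner ℝ u w = r * m := fun u hu w hw => by
    induction hu using Submodule.span_induction with
    | mem u hu => obtain ⟨j, rfl⟩ := hu; exact hbu j w hw
    | zero => exact ⟨0, by simp⟩
    | add u u' _ _ hu hu' =>
      obtain ⟨m, hm⟩ := hu
      obtain ⟨l, hl⟩ := hu'
      exact ⟨m + l, by rw [inner_add_left, hm, hl]; push_cast; ring⟩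
    | smul a u _ hu =>
      obtain ⟨m, hm⟩ := hu
      refine ⟨a * m, ?_⟩
      rw [← Int.cast_smul_eq_zsmul ℝ, inner_smul_left, hm, RCLike.conj_to_real]; push_cast; ring
  have heven : ∀ u ∈ Λ, ∃ m : ℤ, ‖u‖ ^ 2 = 2 * r * m := fun u hu => by
    induction hu using Submodule.span_induction with
    | mem u hu =>
      obtain ⟨j, rfl⟩ := hu
      refine ⟨1, ?_⟩
      rw [← real_inner_self_eq_norm_sq, hG, hdiag]; push_cast; ring
    | zero => exact ⟨0, by simp⟩
    | add u u' hu1 hu2 hu hu' =>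
      obtain ⟨m, hm⟩ := hu
      obtain ⟨l, hl⟩ := hu'
      obtain ⟨p, hp⟩ := huw u hu1 u' hu2
      exact ⟨m + l + p, by rw [norm_add_sq_real, hm, hl, hp]; push_cast; ring⟩
    | smul a u _ hu =>
      obtain ⟨m, hm⟩ := hu
      refine ⟨a ^ 2 * m, ?_⟩
      rw [← Int.cast_smul_eq_zsmul ℝ, norm_smul, mul_pow, hm, Real.norm_eq_abs, sq_abs]
      push_cast; ring
  have hbn : ∀ i, ‖b i‖ ^ 2 = 2 * r := fun i => by
    rw [← real_inner_self_eq_norm_sq, hG, hdiag]; push_cast; ring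
  -- By evenness, distinct lattice points have squared distance at least `2 * r`; expanding `‖v - u‖
  -- ^ 2 ≥ 2 * r` for a root `v` gives the claim.
  have hroot : ∀ v ∈ Λ, ‖v‖ ^ 2 = 2 * r → ∀ u ∈ Λ, u ≠ v → 2 * inner ℝ v u ≤ ‖u‖ ^ 2 :=
    fun v hv hvn u hu huv => by
    obtain ⟨m, hm⟩ := heven (v - u) (Λ.sub_mem hv hu)
    have hpos : 0 < ‖v - u‖ ^ 2 := by
      have := norm_pos_iff.2 (sub_ne_zero.2 huv.symm)
      positivity
    have hm1 : 1 ≤ m := by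
      by_contra! hcon
      have : (m : ℝ) ≤ 0 := by exact_mod_cast Int.lt_add_one_iff.1 hcon
      nlinarith
    have hm1' : (1 : ℝ) ≤ m := by exact_mod_cast hm1
    rw [norm_sub_sq_real] at hm
    nlinarith
  have hnegn : ‖-b j₀‖ ^ 2 = 2 * r := by rw [norm_neg, hbn]
  have hgram : inner ℝ (b i₀) (b j₀) = -r := by rw [hG, hneg]; push_cast; ring
  -- Two simple roots joined in the diagram form an obtuse angle; negating one makes it acute, and
  -- the midpoint of the negated root serves as `x`.
  refine not_isRefinable_of_relevant b b hb le_rfl (v := b i₀) (w := -b j₀)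
    (x := (1 / 2 : ℝ) • -b j₀) (hb _) (b.ne_zero _) (fun u hu hu0 huv => ?_)
    (Λ.neg_mem (hb _)) (fun u hu => ?_) ?_ ?_ ?_ k
  · have h1 := hroot _ (hb i₀) (hbn _) u hu huv
    have h2 := norm_pos_iff.2 hu0
    nlinarith [pow_pos h2 2]
  · rw [inner_smul_left, RCLike.conj_to_real]
    rcases eq_or_ne u (-b j₀) with rfl | hne
    · rw [real_inner_self_eq_norm_sq]; linarith
    · have := hroot _ (Λ.neg_mem (hb j₀)) hnegn u hu hne
      nlinarith [sq_nonneg ‖u‖]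
  · rw [inner_smul_left, RCLike.conj_to_real, real_inner_self_eq_norm_sq]; ring
  · rw [inner_neg_right, hgram, neg_neg]; exact hr
  · rw [inner_smul_right, inner_neg_right, hgram, hbn]; linarith

end RelevantVectors

/-! ### The dual lattices `Aₙ*`. -/

section DualA

/-- Points of `Aₙ*`, in coordinates of sum zero that are congruent modulo `1`: the vector with
coordinates `n / (n + 1), -1 / (n + 1), …, -1 / (n + 1)` is Voronoi-relevant. -/
theorem lt_sum_sq_of_sum_eq_zero {n : ℕ} (hn : 1 ≤ n) {Y : Fin (n + 1) → ℝ} (i₀ : Fin (n + 1))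
    (hsum : ∑ i, Y i = 0) (hint : ∀ i, ∃ k : ℤ, Y i = Y i₀ + k) (h0 : Y ≠ 0)
    (h1 : ¬ ∀ i ≠ i₀, Y i = Y i₀ - 1) : Y i₀ < ∑ i, Y i ^ 2 := by
  set c := Y i₀ with hc
  set I := Finset.univ.erase i₀ with hI
  have hmem : i₀ ∈ (Finset.univ : Finset (Fin (n + 1))) := Finset.mem_univ _
  have hcard : (I.card : ℝ) = n := by
    rw [hI, Finset.card_erase_of_mem hmem, Finset.card_univ, Fintype.card_fin]; simp
  have hs1 : ∑ i ∈ I, Y i = -c := by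
    have := Finset.add_sum_erase Finset.univ Y hmem
    linarith
  have hs2 : ∑ i, Y i ^ 2 = c ^ 2 + ∑ i ∈ I, Y i ^ 2 :=
    (Finset.add_sum_erase Finset.univ (fun i => Y i ^ 2) hmem).symm
  have hn0 : (1 : ℝ) ≤ n := by exact_mod_cast hn
  rcases le_or_gt c 0 with hc0 | hc0
  · obtain ⟨i, hi⟩ := Function.ne_iff.1 h0
    exact hc0.trans_lt (Finset.sum_pos' (fun i _ => sq_nonneg _)
      ⟨i, Finset.mem_univ _, by simp only [Pi.zero_apply] at hi; positivity⟩)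
  rcases lt_or_ge (n : ℝ) ((n + 1) * c) with hc1 | hc1
  -- For `c > n / (n + 1)`, Cauchy-Schwarz on the other coordinates, of sum `-c`, gives a total of
  -- at least `c ^ 2 * (n + 1) / n > c`.
  · have := sq_sum_le_card_mul_sum_sq (s := I) (f := Y)
    rw [hs1, hcard] at this
    rw [hs2]
    have h3 : (n : ℝ) * c < n * (c ^ 2 + ∑ i ∈ I, Y i ^ 2) := by nlinarith
    exact lt_of_mul_lt_mul_left h3 (by linarith)
  by_contra! hcon
  rw [hs2] at hcon
  -- Here integrality enters: `k * (k + 1) ≥ 0` for the integers `k = Y i - c`. Summed up, this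
  -- forces `c = n / (n + 1)` and every `k` to be `0` or `-1`; the zero sum then leaves only `k =
  -- -1`, the excluded vector.
  have hk : ∀ i ∈ I, 0 ≤ (Y i - c + 1) * (Y i - c) := fun i _ => by
    obtain ⟨k, hk⟩ := hint i
    rw [hk]
    have : 0 ≤ (k + 1) * k := by
      rcases le_or_gt 0 k with h | h <;> nlinarith
    have : (0 : ℝ) ≤ (k + 1) * k := by exact_mod_cast this
    linarith
  have hprod : ∑ i ∈ I, (Y i - c + 1) * (Y i - c) =
      ∑ i ∈ I, Y i ^ 2 - (2 * c - 1) * ∑ i ∈ I, Y i + n * (c * (c - 1)) := by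
    rw [Finset.mul_sum, ← Finset.sum_sub_distrib, ← hcard, ← nsmul_eq_mul, ← Finset.sum_const,
      ← Finset.sum_add_distrib]
    exact Finset.sum_congr rfl fun i _ => by ring
  have hnn := Finset.sum_nonneg hk
  rw [hs1] at hprod
  have hn1 : (n : ℝ) ≤ (n + 1) * c := by
    by_contra! hlt
    nlinarith
  have hzero : ∑ i ∈ I, (Y i - c + 1) * (Y i - c) = 0 := by
    refine le_antisymm ?_ hnn
    rw [hprod]
    nlinarith
  have heach := (Finset.sum_eq_zero_iff_of_nonneg hk).1 hzero
  have hge : ∀ i ∈ I, 0 ≤ Y i - c + 1 := fun i hi => by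
    rcases mul_eq_zero.1 (heach i hi) with h | h <;> linarith
  have hlin : ∑ i ∈ I, (Y i - c + 1) = 0 := by
    rw [Finset.sum_add_distrib, Finset.sum_sub_distrib, hs1, Finset.sum_const, Finset.sum_const,
      nsmul_eq_mul, nsmul_eq_mul, hcard]
    linarith
  refine h1 fun i hi => ?_
  have := (Finset.sum_eq_zero_iff_of_nonneg hge).1 hlin i
    (Finset.mem_erase.2 ⟨hi, Finset.mem_univ _⟩)
  linarith

theorem le_sum_sq_of_sum_eq_zero {n : ℕ} (hn : 1 ≤ n) {Y : Fin (n + 1) → ℝ} (i₀ : Fin (n + 1))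
    (hsum : ∑ i, Y i = 0) (hint : ∀ i, ∃ k : ℤ, Y i = Y i₀ + k) : Y i₀ ≤ ∑ i, Y i ^ 2 := by
  by_cases h0 : Y = 0
  · simp [h0]
  by_cases h1 : ∀ i ≠ i₀, Y i = Y i₀ - 1
  · have hmem : i₀ ∈ (Finset.univ : Finset (Fin (n + 1))) := Finset.mem_univ _
    have hcard : ((Finset.univ.erase i₀).card : ℝ) = n := by
      rw [Finset.card_erase_of_mem hmem, Finset.card_univ, Fintype.card_fin]; simp
    have e1 : ∑ i ∈ Finset.univ.erase i₀, Y i = n * (Y i₀ - 1) := by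
      rw [Finset.sum_congr rfl fun i hi => h1 i (Finset.ne_of_mem_erase hi), Finset.sum_const,
        nsmul_eq_mul, hcard]
    have e2 : ∑ i ∈ Finset.univ.erase i₀, Y i ^ 2 = n * (Y i₀ - 1) ^ 2 := by
      rw [Finset.sum_congr rfl fun i hi =>
        congrArg (· ^ 2) (h1 i (Finset.ne_of_mem_erase hi)), Finset.sum_const, nsmul_eq_mul, hcard]
    rw [← Finset.add_sum_erase _ _ hmem, e1] at hsum
    rw [← Finset.add_sum_erase _ _ hmem, e2]
    nlinarith
  · exact (lt_sum_sq_of_sum_eq_zero hn i₀ hsum hint h0 h1).le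

variable {E : Type*} [NormedAddCommGroup E] [InnerProductSpace ℝ E]

/-- An identity of an inner product with a dot product of coordinates can be checked on a basis. -/
theorem inner_eq_mul_dotProduct_of_basis {ι κ : Type*} [Fintype κ] (b : Module.Basis ι ℝ E)
    (Y : E →ₗ[ℝ] (κ → ℝ)) (c : ℝ) (h : ∀ i j, inner ℝ (b i) (b j) = c * (Y (b i) ⬝ᵥ Y (b j)))
    (x y : E) : inner ℝ x y = c * (Y x ⬝ᵥ Y y) := by
  have hx : x ∈ Submodule.span ℝ (Set.range b) := by rw [b.span_eq]; trivial
  have hy : y ∈ Submodule.span ℝ (Set.range b) := by rw [b.span_eq]; trivial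
  induction hx, hy using Submodule.span_induction₂ with
  | mem_mem x y hx hy =>
    obtain ⟨i, rfl⟩ := hx
    obtain ⟨j, rfl⟩ := hy
    exact h i j
  | zero_left => simp
  | zero_right => simp
  | add_left x y z _ _ _ hx hy => rw [inner_add_left, hx, hy, map_add, add_dotProduct, mul_add]
  | add_right x y z _ _ _ hx hy => rw [inner_add_right, hx, hy, map_add, dotProduct_add, mul_add]
  | smul_left a x y _ _ hx =>
    rw [inner_smul_left, hx, map_smul, smul_dotProduct, RCLike.conj_to_real, smul_eq_mul,
      mul_left_comm]
  | smul_right a x y _ _ hx =>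
    rw [inner_smul_right, hx, map_smul, dotProduct_smul, smul_eq_mul, mul_left_comm]

theorem mem_dual_span_iff {ι : Type*} {Λ : Submodule ℤ E} (b : Module.Basis ι ℝ E)
    (hΛ : ∀ x, x ∈ Λ ↔ ∀ y ∈ Submodule.span ℤ (Set.range b), ∃ m : ℤ, inner ℝ x y = (m : ℝ))
    (x : E) : x ∈ Λ ↔ ∀ i, ∃ m : ℤ, inner ℝ (b i) x = m := by
  rw [hΛ]
  refine ⟨fun h i => ?_, fun h y hy => ?_⟩
  · rw [real_inner_comm]
    exact h _ (Submodule.subset_span ⟨i, rfl⟩)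
  · induction hy using Submodule.span_induction with
    | mem y hy => obtain ⟨i, rfl⟩ := hy; rw [real_inner_comm]; exact h i
    | zero => exact ⟨0, by simp⟩
    | add y z _ _ hy hz =>
      obtain ⟨m, hm⟩ := hy
      obtain ⟨l, hl⟩ := hz
      exact ⟨m + l, by rw [inner_add_right, hm, hl]; push_cast; ring⟩
    | smul a y _ hy =>
      obtain ⟨m, hm⟩ := hy
      refine ⟨a * m, ?_⟩
      rw [← Int.cast_smul_eq_zsmul ℝ, inner_smul_right, hm]; push_cast; ring

variable [FiniteDimensional ℝ E] [MeasurableSpace E] [BorelSpace E]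

theorem not_isRefinable_of_isDualOfGramMatrix_A {n : ℕ} (hn : 2 ≤ n) {Λ : Submodule ℤ E}
    (hΛ : IsDualOfGramMatrix (CartanMatrix.A n) Λ) (k : ℕ) : ¬ IsRefinable Λ k := by
  obtain ⟨_, ⟨r, hr, b, hG, rfl⟩, hdual⟩ := hΛ
  have hmem := mem_dual_span_iff b hdual
  set T := innerCoordEquiv b with hT
  have hTs : ∀ y i, inner ℝ (b i) (T.symm y) = y i := fun y i => by
    rw [← innerCoordEquiv_apply, ← hT, T.apply_symm_apply]
  -- The basis dual to the simple roots, that is, the fundamental weights; it spans `Λ` over `ℤ`.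
  set d := Module.Basis.ofEquivFun T with hd
  have hdmem : ∀ j, T.symm (Pi.single j 1) ∈ Λ := fun j => (hmem _).2 fun i => by
    rw [hTs]
    by_cases h : i = j
    · subst h; exact ⟨1, by simp⟩
    · exact ⟨0, by simp [h]⟩
  have hΛd : Λ ≤ Submodule.span ℤ (Set.range d) := fun x hx => by
    rw [Module.Basis.mem_span_iff_repr_mem]
    intro i
    obtain ⟨m, hm⟩ := (hmem x).1 hx i
    exact ⟨m, by simp [hd, hT, hm]⟩
  -- The factor `r` makes the pairing with a simple root equal to a difference of consecutive
  -- coordinates, so that points of the dual lattice have coordinates congruent modulo `1`.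
  set Y : E →ₗ[ℝ] (Fin (n + 1) → ℝ) :=
    b.constr ℝ fun i => r • (Pi.single i.castSucc 1 - Pi.single i.succ 1) with hY
  have hYb : ∀ i, Y (b i) = r • (Pi.single i.castSucc 1 - Pi.single i.succ 1) := fun i => by
    rw [hY, Module.Basis.constr_basis]
  have hin : ∀ x y, inner ℝ x y = r⁻¹ * (Y x ⬝ᵥ Y y) := by
    refine inner_eq_mul_dotProduct_of_basis b Y r⁻¹ fun i j => ?_
    rw [hG, hYb, hYb, smul_dotProduct, dotProduct_smul, smul_eq_mul, smul_eq_mul,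
      inv_mul_cancel_left₀ hr.ne']
    congr 1
    simp only [sub_dotProduct, single_dotProduct, Pi.sub_apply, Pi.single_apply, one_mul,
      CartanMatrix.A, Matrix.of_apply, Fin.ext_iff, Fin.val_castSucc, Fin.val_succ]
    split_ifs <;> first | omega | norm_num
  have hbY : ∀ i x, inner ℝ (b i) x = Y x i.castSucc - Y x i.succ := fun i x => by
    rw [hin, hYb, smul_dotProduct, smul_eq_mul, inv_mul_cancel_left₀ hr.ne', sub_dotProduct,
      single_dotProduct, single_dotProduct, one_mul, one_mul]
  have hsum : ∀ x, ∑ i, Y x i = 0 := fun x => by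
    have hx : x ∈ Submodule.span ℝ (Set.range b) := by rw [b.span_eq]; trivial
    induction hx using Submodule.span_induction with
    | mem x hx =>
      obtain ⟨i, rfl⟩ := hx
      simp [hYb, Finset.sum_sub_distrib, ← Finset.mul_sum, Finset.sum_pi_single']
    | zero => simp
    | add x y _ _ hx hy => simp [Finset.sum_add_distrib, hx, hy]
    | smul a x _ hx => simp [← Finset.mul_sum, hx]
  have hYinj : ∀ x y, Y x = Y y → x = y := fun x y hxy => by
    have : inner ℝ (x - y) (x - y) = (0 : ℝ) := by rw [hin, map_sub, hxy, sub_self]; simp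
    exact sub_eq_zero.1 (inner_self_eq_zero.1 this)
  have hnorm : ∀ x, ‖x‖ ^ 2 = r⁻¹ * ∑ i, Y x i ^ 2 := fun x => by
    rw [← real_inner_self_eq_norm_sq, hin]
    simp only [dotProduct, sq]
  have hint : ∀ u ∈ Λ, ∀ i, ∃ m : ℤ, Y u i = Y u 0 + m := fun u hu i => by
    induction i using Fin.induction with
    | zero => exact ⟨0, by simp⟩
    | succ i ih =>
      obtain ⟨m, hm⟩ := ih
      obtain ⟨l, hl⟩ := (hmem u).1 hu i
      rw [hbY] at hl
      exact ⟨m - l, by push_cast; linarith⟩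
  have hint' : ∀ u ∈ Λ, ∀ i j, ∃ m : ℤ, Y u i = Y u j + m := fun u hu i j => by
    obtain ⟨m, hm⟩ := hint u hu i
    obtain ⟨l, hl⟩ := hint u hu j
    exact ⟨m - l, by push_cast; linarith⟩
  obtain ⟨n, rfl⟩ : ∃ p, n = p + 2 := ⟨n - 2, by omega⟩
  have hr' : 0 < r⁻¹ := inv_pos.2 hr
  -- the two extreme fundamental weights
  set v := T.symm (Pi.single 0 1) with hv
  set w := T.symm (Pi.single (Fin.last (n + 1)) 1) with hw
  have hYv : ∀ i : Fin (n + 2), Y v i.succ = Y v 0 - 1 := fun i => by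
    induction i using Fin.induction with
    | zero =>
      have := hbY 0 v
      rw [hTs, Pi.single_eq_same] at this
      simp only [Fin.castSucc_zero] at this
      linarith
    | succ i ih =>
      have := hbY i.succ v
      rw [hTs, Pi.single_eq_of_ne (Fin.succ_ne_zero i)] at this
      rw [← Fin.succ_castSucc, ih] at this
      linarith
  have hYw : ∀ i : Fin (n + 2), Y w i.castSucc = Y w 0 := fun i => by
    induction i using Fin.induction with
    | zero => simp
    | succ i ih =>
      have := hbY i.castSucc w
      rw [hTs, Pi.single_eq_of_ne (Fin.castSucc_ne_last i)] at this
      rw [← Fin.succ_castSucc]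
      linarith
  have hYwl : Y w (Fin.last (n + 2)) = Y w 0 - 1 := by
    have := hbY (Fin.last (n + 1)) w
    rw [hTs, Pi.single_eq_same, hYw, Fin.succ_last] at this
    linarith
  have hv0 : ((n : ℝ) + 3) * Y v 0 = n + 2 := by
    have := hsum v
    rw [Fin.sum_univ_succ] at this
    simp only [hYv, Finset.sum_const, Finset.card_univ, Fintype.card_fin, nsmul_eq_mul] at this
    push_cast at this
    linarith
  have hw0 : ((n : ℝ) + 3) * Y w 0 = 1 := by
    have := hsum w
    rw [Fin.sum_univ_castSucc] at this
    simp only [hYw, hYwl, Finset.sum_const, Finset.card_univ, Fintype.card_fin,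
      nsmul_eq_mul] at this
    push_cast at this
    linarith
  have hinv : ∀ u, inner ℝ v u = r⁻¹ * Y u 0 := fun u => by
    rw [hin, dotProduct, Fin.sum_univ_succ]
    have := hsum u
    rw [Fin.sum_univ_succ] at this
    simp only [hYv, ← Finset.mul_sum]
    rw [eq_neg_of_add_eq_zero_right this]
    ring
  have hinw : ∀ u, inner ℝ w u = r⁻¹ * -Y u (Fin.last (n + 2)) := fun u => by
    rw [hin, dotProduct, Fin.sum_univ_castSucc]
    have := hsum u
    rw [Fin.sum_univ_castSucc] at this
    simp only [hYw, hYwl, ← Finset.mul_sum]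
    rw [eq_neg_of_add_eq_zero_left this]
    ring
  have hn0 : (0 : ℝ) ≤ n := Nat.cast_nonneg n
  have hYw0 : 0 < Y w 0 := by nlinarith
  -- This keeps `x = w / 2` off the bisector of `v`. It needs rank at least `2`: in rank one the two
  -- weights coincide.
  have hYvw : Y w 0 < Y v 0 := by nlinarith
  have hvne : v ≠ 0 := by
    intro h
    have := hinv v
    rw [h, inner_zero_left, map_zero] at this
    rw [h, map_zero] at hYvw
    exact absurd hYw0 (not_lt.2 (by simpa using hYvw.le))
  refine not_isRefinable_of_relevant d d (fun j => ?_) hΛd (hdmem 0) hvne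
    (fun u hu hu0 huv => ?_) (w := w) (x := (1 / 2 : ℝ) • w) (hdmem _) (fun u hu => ?_) ?_ ?_ ?_ k
  · rw [hd, Module.Basis.coe_ofEquivFun]; exact hdmem j
  · rw [hinv, hnorm]
    refine mul_lt_mul_of_pos_left (lt_sum_sq_of_sum_eq_zero (by omega) 0 (hsum u)
      (fun i => hint' u hu i 0) (fun h => hu0 (hYinj _ _ (by rw [h, map_zero]))) fun h => ?_) hr'
    have hu' : ∀ i : Fin (n + 2), Y u i.succ = Y u 0 - 1 := fun i => h _ (Fin.succ_ne_zero i)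
    have hs := hsum u
    rw [Fin.sum_univ_succ] at hs
    simp only [hu', Finset.sum_const, Finset.card_univ, Fintype.card_fin, nsmul_eq_mul] at hs
    push_cast at hs
    have h00 : Y u 0 = Y v 0 := by
      have h3 : ((n : ℝ) + 3) ≠ 0 := by positivity
      exact mul_left_cancel₀ h3 (by linarith)
    refine huv (hYinj _ _ (funext fun i => ?_))
    induction i using Fin.cases with
    | zero => exact h00
    | succ i => rw [hu', hYv, h00]
  · rw [inner_smul_left, RCLike.conj_to_real, hinw, hnorm]
    -- Up to sign, `w` is the analogue of `v` for the last coordinate.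
    have := le_sum_sq_of_sum_eq_zero (Y := -Y u) (by omega) (Fin.last (n + 2))
      (by simp [hsum u]) fun i => by
        obtain ⟨m, hm⟩ := hint' u hu i (Fin.last (n + 2))
        exact ⟨-m, by simp only [Pi.neg_apply, hm]; push_cast; ring⟩
    simp only [Pi.neg_apply, neg_sq] at this
    have := mul_le_mul_of_nonneg_left this hr'.le
    linarith
  · rw [inner_smul_left, RCLike.conj_to_real, real_inner_self_eq_norm_sq]; ring
  · rw [hinv]; positivity
  · rw [inner_smul_right, hinv, ← real_inner_self_eq_norm_sq, hinv]
    nlinarith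

end DualA

/-! ### Centered cubic lattices and the split `Bₙ`. -/

section CenteredCubic

/-- All coordinates are integers, or all of them are half-odd integers. -/
def IsIntegralOrHalfOdd {n : ℕ} (Y : Fin n → ℝ) : Prop :=
  (∀ i, ∃ m : ℤ, Y i = m) ∨ ∀ i, ∃ m : ℤ, Y i = m + 1 / 2

theorem IsIntegralOrHalfOdd.add {n : ℕ} {Y Z : Fin n → ℝ} (hY : IsIntegralOrHalfOdd Y)
    (hZ : IsIntegralOrHalfOdd Z) : IsIntegralOrHalfOdd (Y + Z) := by
  rcases hY with hY | hY <;> rcases hZ with hZ | hZ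
  · refine Or.inl fun i => ?_
    obtain ⟨m, hm⟩ := hY i
    obtain ⟨l, hl⟩ := hZ i
    exact ⟨m + l, by simp [hm, hl]⟩
  · refine Or.inr fun i => ?_
    obtain ⟨m, hm⟩ := hY i
    obtain ⟨l, hl⟩ := hZ i
    exact ⟨m + l, by simp [hm, hl]; ring⟩
  · refine Or.inr fun i => ?_
    obtain ⟨m, hm⟩ := hY i
    obtain ⟨l, hl⟩ := hZ i
    exact ⟨m + l, by simp [hm, hl]; ring⟩
  · refine Or.inl fun i => ?_
    obtain ⟨m, hm⟩ := hY i
    obtain ⟨l, hl⟩ := hZ i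
    exact ⟨m + l + 1, by simp [hm, hl]; ring⟩

theorem IsIntegralOrHalfOdd.zero {n : ℕ} : IsIntegralOrHalfOdd (0 : Fin n → ℝ) :=
  Or.inl fun _ => ⟨0, by simp⟩

theorem IsIntegralOrHalfOdd.neg {n : ℕ} {Y : Fin n → ℝ} (hY : IsIntegralOrHalfOdd Y) :
    IsIntegralOrHalfOdd (-Y) := by
  rcases hY with hY | hY
  · refine Or.inl fun i => ?_
    obtain ⟨m, hm⟩ := hY i
    exact ⟨-m, by simp [hm]⟩
  · refine Or.inr fun i => ?_
    obtain ⟨m, hm⟩ := hY i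
    exact ⟨-m - 1, by simp [hm]; ring⟩

theorem IsIntegralOrHalfOdd.zsmul {n : ℕ} {Y : Fin n → ℝ} (hY : IsIntegralOrHalfOdd Y) (a : ℤ) :
    IsIntegralOrHalfOdd (a • Y) := by
  induction a with
  | zero => rw [zero_smul]; exact .zero
  | succ a ih => rw [add_smul, one_smul]; exact ih.add hY
  | pred a ih => rw [sub_smul, one_smul, sub_eq_add_neg]; exact ih.add hY.neg

theorem intCast_le_sq (m : ℤ) : (m : ℝ) ≤ m ^ 2 := by
  exact_mod_cast Int.le_self_sq m

theorem quarter_le_sq_int_add_half (m : ℤ) : (1 / 4 : ℝ) ≤ ((m : ℝ) + 1 / 2) ^ 2 := by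
  have : 0 ≤ m * (m + 1) := by rcases le_or_gt 0 m with h | h <;> nlinarith
  have : (0 : ℝ) ≤ m * (m + 1) := by exact_mod_cast this
  nlinarith

/-- For half-odd points `Y i₀ ^ 2 - Y i₀ ≥ -1 / 4`, while the other `n - 1` squares contribute at
least `1 / 4` each. With `n = 2` the point `(1/2, 1/2)` gives equality, so `n ≥ 3` is essential. -/
theorem IsIntegralOrHalfOdd.lt_sum_sq {n : ℕ} (hn : 3 ≤ n) {Y : Fin n → ℝ}
    (hY : IsIntegralOrHalfOdd Y) (i₀ : Fin n) (h0 : Y ≠ 0) (h1 : Y ≠ Pi.single i₀ 1) :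
    Y i₀ < ∑ i, Y i ^ 2 := by
  have hmem : i₀ ∈ (Finset.univ : Finset (Fin n)) := Finset.mem_univ _
  rw [← Finset.add_sum_erase _ _ hmem]
  rcases hY with hY | hY
  · obtain ⟨m, hm⟩ := hY i₀
    have hm1 := intCast_le_sq m
    have hS : 0 ≤ ∑ i ∈ Finset.univ.erase i₀, Y i ^ 2 := Finset.sum_nonneg fun _ _ => sq_nonneg _
    by_contra! hcon
    rw [hm] at hcon
    have hSz : ∑ i ∈ Finset.univ.erase i₀, Y i ^ 2 = 0 := by linarith
    have hz : ∀ i ≠ i₀, Y i = 0 := fun i hi => by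
      have := (Finset.sum_eq_zero_iff_of_nonneg fun _ _ => sq_nonneg _).1 hSz i
        (Finset.mem_erase.2 ⟨hi, Finset.mem_univ _⟩)
      exact pow_eq_zero_iff two_ne_zero |>.1 this
    have hmm : (m : ℝ) * (m - 1) = 0 := by nlinarith
    rcases mul_eq_zero.1 hmm with h | h
    · refine h0 (funext fun i => ?_)
      by_cases hi : i = i₀
      · rw [hi, hm, h]; rfl
      · exact hz i hi
    · refine h1 (funext fun i => ?_)
      by_cases hi : i = i₀
      · rw [hi, hm, Pi.single_eq_same]; linarith
      · rw [hz i hi, Pi.single_eq_of_ne hi]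
  · have hcard : ((Finset.univ.erase i₀).card : ℝ) = n - 1 := by
      rw [Finset.card_erase_of_mem hmem, Finset.card_univ, Fintype.card_fin,
        Nat.cast_sub (by omega), Nat.cast_one]
    have hS := Finset.card_nsmul_le_sum (Finset.univ.erase i₀) (fun i => Y i ^ 2) (1 / 4)
      fun i _ => by obtain ⟨m, hm⟩ := hY i; simp only [hm]; exact quarter_le_sq_int_add_half m
    rw [nsmul_eq_mul, hcard] at hS
    have hn3 : (3 : ℝ) ≤ n := by exact_mod_cast hn
    nlinarith [sq_nonneg (Y i₀ - 1 / 2)]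

/-- This places the point with coordinate `0` at `i₀` and `c` elsewhere in the cell. Integral points
are handled coordinatewise by `2 c m ≤ m ^ 2`. For half-odd points each coordinate other than `i₀`
contributes at least `1 / 4 - c` and the one at `i₀` at least `1 / 4`, whence the condition on `(n -
1) * c`. -/
theorem IsIntegralOrHalfOdd.two_mul_sum_le {n : ℕ} {Y : Fin n → ℝ}
    (hY : IsIntegralOrHalfOdd Y) (i₀ : Fin n) {c : ℝ} (hc0 : 0 ≤ c) (hc1 : 2 * c ≤ 1)
    (hc : 4 * ((n - 1) * c) ≤ n) :
    2 * (c * ∑ i ∈ Finset.univ.erase i₀, Y i) ≤ ∑ i, Y i ^ 2 := by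
  have hmem : i₀ ∈ (Finset.univ : Finset (Fin n)) := Finset.mem_univ _
  rw [← Finset.add_sum_erase _ _ hmem]
  rcases hY with hY | hY
  · have : 2 * (c * ∑ i ∈ Finset.univ.erase i₀, Y i) ≤ ∑ i ∈ Finset.univ.erase i₀, Y i ^ 2 := by
      rw [Finset.mul_sum, Finset.mul_sum]
      refine Finset.sum_le_sum fun i _ => ?_
      obtain ⟨m, hm⟩ := hY i
      have h1 := intCast_le_sq m
      rw [hm]
      nlinarith [sq_nonneg (m : ℝ)]
    nlinarith [sq_nonneg (Y i₀)]
  · have hcard : ((Finset.univ.erase i₀).card : ℝ) = n - 1 := by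
      rw [Finset.card_erase_of_mem hmem, Finset.card_univ, Fintype.card_fin,
        Nat.cast_sub (by have := i₀.pos; omega), Nat.cast_one]
    have hS := Finset.card_nsmul_le_sum (Finset.univ.erase i₀)
      (fun i => Y i ^ 2 - 2 * (c * Y i)) (1 / 4 - c) fun i _ => by
        obtain ⟨m, hm⟩ := hY i
        have : 0 ≤ (m : ℝ) * (m + 1 - 2 * c) := by
          rcases le_or_gt 0 m with h | h
          · have : (0 : ℝ) ≤ m := by exact_mod_cast h
            exact mul_nonneg this (by linarith)
          · have : (m : ℝ) + 1 ≤ 0 := by exact_mod_cast h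
            exact mul_nonneg_of_nonpos_of_nonpos (by linarith) (by linarith)
        simp only [hm]
        nlinarith
    rw [nsmul_eq_mul, hcard, Finset.sum_sub_distrib, ← Finset.mul_sum, ← Finset.mul_sum] at hS
    obtain ⟨m, hm⟩ := hY i₀
    have := quarter_le_sq_int_add_half m
    rw [← hm] at this
    linarith

variable {E : Type*} [NormedAddCommGroup E] [InnerProductSpace ℝ E] [FiniteDimensional ℝ E]
  [MeasurableSpace E] [BorelSpace E]

/-- Lattices similar to `ℤⁿ ∪ (ℤⁿ + (1/2, …, 1/2))`, `n ≥ 3`. -/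
theorem not_isRefinable_of_isIntegralOrHalfOdd {n : ℕ} (hn : 3 ≤ n) {Λ : Submodule ℤ E}
    (Y : E ≃ₗ[ℝ] (Fin n → ℝ)) {r : ℝ} (hr : 0 < r)
    (hin : ∀ x y, inner ℝ x y = r * (Y x ⬝ᵥ Y y)) (hΛ : ∀ x ∈ Λ, IsIntegralOrHalfOdd (Y x))
    (hsingle : ∀ i, Y.symm (Pi.single i 1) ∈ Λ) (hhalf : Y.symm (fun _ => 1 / 2) ∈ Λ) (k : ℕ) :
    ¬ IsRefinable Λ k := by
  set b := Module.Basis.ofEquivFun Y with hb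
  -- Halving the unit vectors gives a basis whose integral span contains the half-odd points too.
  set b' := Module.Basis.ofEquivFun (Y.trans (LinearEquiv.smulOfNeZero ℝ _ (2 : ℝ) two_ne_zero))
    with hb'
  have hn3 : (3 : ℝ) ≤ n := by exact_mod_cast hn
  let i₀ : Fin n := ⟨0, by omega⟩
  -- The value for which `x = (0, c, …, c)` lies on the bisector of `w = (1/2, …, 1/2)`.
  set c : ℝ := n / (4 * (n - 1)) with hc
  have hn1 : (0 : ℝ) < 4 * (n - 1) := by linarith
  have hc0 : 0 ≤ c := div_nonneg (by linarith) hn1.le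
  have hcn : 4 * ((n - 1) * c) = n := by rw [← mul_assoc, hc, mul_div_cancel₀ _ hn1.ne']
  have hc1 : 2 * c ≤ 1 := by nlinarith
  have hnorm : ∀ x, ‖x‖ ^ 2 = r * ∑ i, Y x i ^ 2 := fun x => by
    rw [← real_inner_self_eq_norm_sq, hin]
    simp only [dotProduct, sq]
  have hmem : i₀ ∈ (Finset.univ : Finset (Fin n)) := Finset.mem_univ _
  have hcard : ((Finset.univ.erase i₀).card : ℝ) = n - 1 := by
    rw [Finset.card_erase_of_mem hmem, Finset.card_univ, Fintype.card_fin,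
      Nat.cast_sub (by omega), Nat.cast_one]
  set v := Y.symm (Pi.single i₀ 1) with hv
  set w := Y.symm (fun _ => 1 / 2) with hw
  set x := Y.symm (Function.update (fun _ => c) i₀ 0) with hx
  have hYv : Y v = Pi.single i₀ 1 := Y.apply_symm_apply _
  have hYw : Y w = fun _ => 1 / 2 := Y.apply_symm_apply _
  have hYx : Y x = Function.update (fun _ => c) i₀ 0 := Y.apply_symm_apply _
  have hinv : ∀ u, inner ℝ v u = r * Y u i₀ := fun u => by
    rw [hin, hYv, single_dotProduct, one_mul]
  have hinx : ∀ u, inner ℝ x u = r * (c * ∑ i ∈ Finset.univ.erase i₀, Y u i) := fun u => by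
    rw [hin, hYx, dotProduct, ← Finset.add_sum_erase _ _ hmem, Function.update_self, zero_mul,
      zero_add]
    congr 1
    rw [Finset.mul_sum]
    exact Finset.sum_congr rfl fun i hi => by
      rw [Function.update_of_ne (Finset.ne_of_mem_erase hi)]
  have hvn : ‖v‖ ^ 2 = r := by
    rw [← real_inner_self_eq_norm_sq, hinv, hYv, Pi.single_eq_same, mul_one]
  refine not_isRefinable_of_relevant b b' (fun i => ?_) (fun u hu => ?_) (hsingle i₀) ?_
    (fun u hu hu0 huv => ?_) hhalf (x := x) (fun u hu => ?_) ?_ ?_ ?_ k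
  · rw [hb, Module.Basis.coe_ofEquivFun]; exact hsingle i
  · rw [Module.Basis.mem_span_iff_repr_mem]
    intro i
    have e : b'.repr u i = 2 * Y u i := by simp [hb']
    rw [e]
    rcases hΛ u hu with h | h
    · obtain ⟨m, hm⟩ := h i
      exact ⟨2 * m, by simp [hm]⟩
    · obtain ⟨m, hm⟩ := h i
      exact ⟨2 * m + 1, by simp [hm]; ring⟩
  · intro h
    change v = 0 at h
    rw [h, norm_zero] at hvn
    nlinarith
  · change inner ℝ v u < _
    rw [hinv, hnorm]
    refine mul_lt_mul_of_pos_left ((hΛ u hu).lt_sum_sq hn i₀ (fun h => hu0 ?_) fun h => huv ?_) hr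
    · exact Y.map_eq_zero_iff.1 h
    · rw [← h, Y.symm_apply_apply]
  · rw [hinx, hnorm]
    have := mul_le_mul_of_nonneg_left ((hΛ u hu).two_mul_sum_le i₀ hc0 hc1 hcn.le) hr.le
    linarith
  · rw [hinx, hnorm, hYw, Finset.sum_const, Finset.sum_const, nsmul_eq_mul, nsmul_eq_mul, hcard,
      Finset.card_univ, Fintype.card_fin]
    linear_combination (r / 4) * hcn
  · change 0 < inner ℝ v w
    rw [hinv, hYw]; positivity
  · change 2 * inner ℝ v x < ‖v‖ ^ 2
    rw [hinv, hYx, Function.update_self, hvn]; linarith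

theorem IsSplitCubeLattice.not_isRefinable {n : ℕ} (hn : 3 ≤ n) {Λ : Submodule ℤ E}
    (hΛ : IsSplitCubeLattice n Λ) (k : ℕ) : ¬ IsRefinable Λ k := by
  obtain ⟨r, hr, e, he, rfl⟩ := hΛ
  have hYe : ∀ i, e.equivFun (e i) = Pi.single i 1 := fun i => by
    ext j
    rw [Module.Basis.equivFun_self, Pi.single_apply]
    simp only [eq_comm]
  refine not_isRefinable_of_isIntegralOrHalfOdd hn e.equivFun hr
    (inner_eq_mul_dotProduct_of_basis e e.equivFun.toLinearMap r fun i j => ?_) (fun x hx => ?_)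
    (fun i => ?_) ?_ k
  · simp only [LinearEquiv.coe_coe, hYe, single_dotProduct, Pi.single_apply, he]
    split_ifs <;> simp
  · induction hx using Submodule.span_induction with
    | mem x hx =>
      rcases hx with ⟨i, rfl⟩ | ⟨ε, hε, rfl⟩
      · rw [hYe]
        refine Or.inl fun j => ?_
        rw [Pi.single_apply]
        split_ifs
        · exact ⟨1, by simp⟩
        · exact ⟨0, by simp⟩
      · refine Or.inr fun j => ?_
        have : e.equivFun ((1 / 2 : ℝ) • ∑ i, ε i • e i) j = 1 / 2 * ε j := by
          rw [map_smul, ← Module.Basis.equivFun_symm_apply, LinearEquiv.apply_symm_apply,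
            Pi.smul_apply, smul_eq_mul]
        rw [this]
        rcases hε j with h | h
        · exact ⟨0, by rw [h]; norm_num⟩
        · exact ⟨-1, by rw [h]; norm_num⟩
    | zero => rw [map_zero]; exact .zero
    | add x y _ _ hx hy => rw [map_add]; exact hx.add hy
    | smul a x _ hx => rw [map_zsmul]; exact hx.zsmul a
  · rw [← hYe, LinearEquiv.symm_apply_apply]
    exact Submodule.subset_span (Or.inl ⟨i, rfl⟩)
  · refine Submodule.subset_span (Or.inr ⟨fun _ => 1, fun _ => Or.inl rfl, ?_⟩)
    rw [Module.Basis.equivFun_symm_apply, Finset.smul_sum]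
    simp

end CenteredCubic

/-! ### The dual lattices `Dₙ*`. -/

section DualD

/-- The simple roots of `Dₙ` in orthonormal coordinates: `εᵢ - εᵢ₊₁`, and `εₙ₋₁ + εₙ` for the
last one. -/
def simpleRootD {n : ℕ} (i : Fin n) : Fin n → ℝ := fun j =>
  if j = i then 1
  else if i.val + 1 < n then (if i.val + 1 = j.val then -1 else 0)
  else if j.val + 2 = n then 1 else 0

theorem simpleRootD_of_lt {n : ℕ} {i : Fin n} (hi : i.val + 1 < n) :
    simpleRootD i = Pi.single i 1 - Pi.single ⟨i.val + 1, hi⟩ 1 := by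
  ext j
  simp only [simpleRootD, hi, if_true, Pi.sub_apply, Pi.single_apply, Fin.ext_iff]
  split_ifs <;> first | omega | norm_num

theorem simpleRootD_last {n : ℕ} (hn : 2 ≤ n) :
    simpleRootD (⟨n - 1, by omega⟩ : Fin n) =
      Pi.single ⟨n - 1, by omega⟩ 1 + Pi.single ⟨n - 2, by omega⟩ 1 := by
  ext j
  simp only [simpleRootD, Pi.add_apply, Pi.single_apply, Fin.ext_iff]
  split_ifs <;> first | omega | norm_num

theorem simpleRootD_dotProduct {n : ℕ} (hn : 3 ≤ n) (i j : Fin n) :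
    simpleRootD i ⬝ᵥ simpleRootD j = (CartanMatrix.D n i j : ℝ) := by
  have key : ∀ i : Fin n, i.val + 1 < n ∨ i = ⟨n - 1, by omega⟩ := fun i => by
    rw [Fin.ext_iff]; have := i.isLt; simp only; omega
  have hj := j.isLt
  rcases key i with hi | rfl
  · rw [simpleRootD_of_lt hi, sub_dotProduct, single_dotProduct, single_dotProduct, one_mul,
      one_mul]
    simp only [simpleRootD, CartanMatrix.D, Matrix.of_apply, Fin.ext_iff]
    split_ifs <;> first | omega | norm_num
  · rw [simpleRootD_last (by omega), add_dotProduct, single_dotProduct, single_dotProduct, one_mul,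
      one_mul]
    simp only [simpleRootD, CartanMatrix.D, Matrix.of_apply, Fin.ext_iff]
    split_ifs <;> first | omega | norm_num

/-- The roots `εᵢ - εᵢ₊₁` make all coordinates congruent modulo `1`; the last root then makes twice
a coordinate an integer, whose parity decides the alternative. -/
theorem isIntegralOrHalfOdd_of_simpleRootD {n : ℕ} (hn : 2 ≤ n) {Y : Fin n → ℝ}
    (hY : ∀ i, ∃ m : ℤ, simpleRootD i ⬝ᵥ Y = m) : IsIntegralOrHalfOdd Y := by
  have hcong : ∀ j (hj : j < n), ∃ m : ℤ, Y ⟨j, hj⟩ = Y ⟨0, by omega⟩ + m := fun j hj => by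
    induction j with
    | zero => exact ⟨0, by simp⟩
    | succ j ih =>
      obtain ⟨m, hm⟩ := ih (by omega)
      obtain ⟨l, hl⟩ := hY ⟨j, by omega⟩
      rw [simpleRootD_of_lt hj, sub_dotProduct, single_dotProduct, single_dotProduct, one_mul,
        one_mul, hm] at hl
      exact ⟨m - l, by push_cast; linarith⟩
  obtain ⟨p, hp⟩ := hY ⟨n - 1, by omega⟩
  rw [simpleRootD_last hn, add_dotProduct, single_dotProduct, single_dotProduct, one_mul,
    one_mul] at hp
  obtain ⟨m₁, h₁⟩ := hcong (n - 1) (by omega)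
  obtain ⟨m₂, h₂⟩ := hcong (n - 2) (by omega)
  have h0 : 2 * Y ⟨0, by omega⟩ = ((p - m₁ - m₂ : ℤ) : ℝ) := by push_cast; linarith
  obtain ⟨q, hq⟩ | ⟨q, hq⟩ := Int.even_or_odd (p - m₁ - m₂)
  · refine Or.inl fun i => ?_
    obtain ⟨m, hm⟩ := hcong i i.isLt
    rw [hq] at h0
    refine ⟨q + m, ?_⟩
    push_cast at h0 ⊢
    linarith
  · refine Or.inr fun i => ?_
    obtain ⟨m, hm⟩ := hcong i i.isLt
    rw [hq] at h0
    refine ⟨q + m, ?_⟩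
    push_cast at h0 ⊢
    linarith

variable {E : Type*} [NormedAddCommGroup E] [InnerProductSpace ℝ E] [FiniteDimensional ℝ E]
  [MeasurableSpace E] [BorelSpace E]

theorem not_isRefinable_of_isDualOfGramMatrix_D {n : ℕ} (hn : 3 ≤ n) {Λ : Submodule ℤ E}
    (hΛ : IsDualOfGramMatrix (CartanMatrix.D n) Λ) (k : ℕ) : ¬ IsRefinable Λ k := by
  obtain ⟨_, ⟨r, hr, b, hG, rfl⟩, hdual⟩ := hΛ
  have hmem := mem_dual_span_iff b hdual
  set Y₀ : E →ₗ[ℝ] (Fin n → ℝ) := b.constr ℝ fun i => r • simpleRootD i with hY₀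
  have hYb : ∀ i, Y₀ (b i) = r • simpleRootD i := fun i => by
    rw [hY₀, Module.Basis.constr_basis]
  have hin : ∀ x y, inner ℝ x y = r⁻¹ * (Y₀ x ⬝ᵥ Y₀ y) := by
    refine inner_eq_mul_dotProduct_of_basis b Y₀ r⁻¹ fun i j => ?_
    rw [hG, hYb, hYb, smul_dotProduct, dotProduct_smul, smul_eq_mul, smul_eq_mul,
      inv_mul_cancel_left₀ hr.ne', simpleRootD_dotProduct hn]
  have hinj : Function.Injective Y₀ := by
    rw [← LinearMap.ker_eq_bot, LinearMap.ker_eq_bot']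
    intro x hx
    have : inner ℝ x x = (0 : ℝ) := by rw [hin, hx]; simp
    exact inner_self_eq_zero.1 this
  let Y : E ≃ₗ[ℝ] (Fin n → ℝ) := Y₀.linearEquivOfInjective hinj
    (by rw [Module.finrank_eq_card_basis b, Module.finrank_fintype_fun_eq_card])
  have hbY : ∀ i x, inner ℝ (b i) x = simpleRootD i ⬝ᵥ Y x := fun i x => by
    rw [hin, hYb, smul_dotProduct, smul_eq_mul, inv_mul_cancel_left₀ hr.ne']
    rfl
  refine not_isRefinable_of_isIntegralOrHalfOdd hn Y (inv_pos.2 hr) hin (fun x hx => ?_)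
    (fun j => ?_) ?_ k
  · refine isIntegralOrHalfOdd_of_simpleRootD (by omega) fun i => ?_
    rw [← hbY]
    exact (hmem x).1 hx i
  · refine (hmem _).2 fun i => ?_
    rw [hbY, Y.apply_symm_apply, dotProduct_single, mul_one]
    unfold simpleRootD
    split_ifs
    exacts [⟨1, by simp⟩, ⟨-1, by simp⟩, ⟨0, by simp⟩, ⟨1, by simp⟩, ⟨0, by simp⟩]
  · refine (hmem _).2 fun i => ?_
    rw [hbY, Y.apply_symm_apply]
    have hi := i.isLt
    by_cases h : i.val + 1 < n
    · rw [simpleRootD_of_lt h, sub_dotProduct, single_dotProduct, single_dotProduct]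
      exact ⟨0, by simp⟩
    · have e : i = ⟨n - 1, by omega⟩ := Fin.ext (by simp only; omega)
      rw [e, simpleRootD_last (by omega), add_dotProduct, single_dotProduct, single_dotProduct]
      exact ⟨1, by norm_num⟩

end DualD

/-! ### The list of lattices. -/

theorem mainTheorem1 {E : Type*} [NormedAddCommGroup E] [InnerProductSpace ℝ E]
    [FiniteDimensional ℝ E] [MeasurableSpace E] [BorelSpace E]
    (Λ : Submodule ℤ E) (hΛ : IsNonCartesianRootLattice Λ) (k : ℕ) :
    ¬ IsRefinable Λ k := by
  rcases hΛ with ⟨n, hn, h⟩ | ⟨n, hn, h⟩ | ⟨n, hn, h⟩ | ⟨n, hn, h⟩ | ⟨n, hn, h⟩ | h | h | h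
  · refine h.not_isRefinable (fun i => by simp [CartanMatrix.A]) (i₀ := ⟨0, by omega⟩)
      (j₀ := ⟨1, by omega⟩) ?_ k
    simp [CartanMatrix.A]
  · exact not_isRefinable_of_isDualOfGramMatrix_A hn h k
  -- In `Dₙ` the last simple root is joined to the node `n - 3`, not to its predecessor `n - 2`.
  · refine h.not_isRefinable (CartanMatrix.D_diag n) (i₀ := ⟨n - 3, by omega⟩)
      (j₀ := ⟨n - 1, by omega⟩) ?_ k
    simp only [CartanMatrix.D, Matrix.of_apply, Fin.ext_iff]
    split_ifs <;> omega
  · exact not_isRefinable_of_isDualOfGramMatrix_D hn h k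
  · exact h.not_isRefinable hn k
  · exact h.not_isRefinable CartanMatrix.E₆_diag (i₀ := 0) (j₀ := 2) (by decide) k
  · exact h.not_isRefinable CartanMatrix.E₇_diag (i₀ := 0) (j₀ := 2) (by decide) k
  · exact h.not_isRefinable CartanMatrix.E₈_diag (i₀ := 0) (j₀ := 2) (by decide) k
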